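/- Let $n\ge 2$ and let $\Omega\subset\mathbb{R}^n$ be a bounded $C^1$ domain that is star-shaped with respect to the origin (so $0\in\Omega$). Let $f\in C^1(\overline{\Omega}\setminus\{0\};\mathbb{R}^n)\cap L^\infty(\Omega;\mathbb{R}^n)$ satisfy $(x\cdot\nabla)f(x)=0$ for $x\in\Omega\setminus\{0\}$ and $f(x)=x$ for $x\in\partial\Omega$, and let $M=\sup_{x\in\Omega}|x|$. Then every real-valued $u\in W^{1,n}(\Omega)$ satisfies $$\int_\Omega \frac{|u-u\circ f|^n}{|x|^n\left(\log\frac{M}{|x|}\right)^n}\,dx\;\le\;\left(\frac{n}{n-1}\right)^n\int_\Omega\left|\frac{x}{|x|}\cdot\nabla u\right|^n dx .$$ Here $\nabla u$ is the weak gradient. Since $f$ maps $\Omega\setminus\{0\}$ into $\partial\Omega$, the function $u\circ f$ is understood as $g\circ f$, where $g\in L^n(\partial\Omega)$ is the boundary trace of $u$, that is, the image of $u$ under the continuous extension to $W^{1,n}(\Omega)$ of the restriction map $v\mapsto v|_{\partial\Omega}$, from $W^{1,n}(\Omega)\cap C(\overline\Omega)$ into $L^n(\partial\Omega)$. (For $u\in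 W^{1,n}(\Omega)\cap C(\overline\Omega)$ it is the ordinary composition.) This trace exists for every such $u$, and in particular the left-hand side is finite. -/

import Mathlib

open MeasureTheory Filter Topology
open scoped ENNReal ContDiff

/-- Euclidean space `ℝⁿ`. -/
abbrev Euc (n : ℕ) : Type := EuclideanSpace ℝ (Fin n)

/-- A `C¹` domain in `ℝⁿ`: a nonempty connected open set `Ω` such that near each boundary point `x₀`
there are an axis `ν` (a unit vector) and a `C¹` function `γ` of the coordinates orthogonal to `ν`
(the component `x - ⟨ν, x⟩ ν` of `x` in the hyperplane `ν^⊥`), such that `Ω` coincides near `x₀`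
with the region lying above the graph of `γ` in the direction `ν`. -/
structure IsC1Domain {n : ℕ} (Ω : Set (Euc n)) : Prop where
  isOpen : IsOpen Ω
  isConnected : IsConnected Ω
  boundary : ∀ x₀ ∈ frontier Ω, ∃ (ν : Euc n) (γ : Euc n → ℝ) (r : ℝ),
    ‖ν‖ = 1 ∧ ContDiff ℝ 1 γ ∧ 0 < r ∧
      ∀ x ∈ Metric.ball x₀ r, x ∈ Ω ↔ γ (x - inner ℝ ν x • ν) < inner ℝ ν x

/-- `Du` is a weak gradient of `u` on the open set `Ω`:
`∫_Ω u ∂ₑφ = - ∫_Ω φ ⟨Du, e⟩` for every test function `φ ∈ C_c^∞(Ω)` and every direction `e`. -/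
structure HasWeakGradient {n : ℕ} (Ω : Set (Euc n)) (u : Euc n → ℝ) (Du : Euc n → Euc n) :
    Prop where
  locallyIntegrable : LocallyIntegrableOn u Ω
  locallyIntegrable_grad : LocallyIntegrableOn Du Ω
  integral_eq : ∀ φ : Euc n → ℝ, ContDiff ℝ ∞ φ → HasCompactSupport φ → tsupport φ ⊆ Ω →
    ∀ e : Euc n,
      ∫ x in Ω, u x * fderiv ℝ φ x e = - ∫ x in Ω, φ x * inner ℝ (Du x) e

/-- `u ∈ W^{1,p}(Ω)`, with weak gradient `Du`. -/
structure MemW1 {n : ℕ} (Ω : Set (Euc n)) (p : ℝ≥0∞) (u : Euc n → ℝ) (Du : Euc n → Euc n) :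
    Prop where
  weakGradient : HasWeakGradient Ω u Du
  memLp : MemLp u p (volume.restrict Ω)
  memLp_grad : MemLp Du p (volume.restrict Ω)

/-- The surface measure of `∂Ω`: the `(n-1)`-dimensional Hausdorff measure on the boundary
(in Mathlib's normalization, which differs from the classical one by a positive constant factor). -/
noncomputable def surfaceMeasure {n : ℕ} (Ω : Set (Euc n)) : Measure (Euc n) :=
  (Measure.hausdorffMeasure ((n : ℝ) - 1)).restrict (frontier Ω)

/-- `g ∈ L^p(∂Ω)` is the boundary trace of `u ∈ W^{1,p}(Ω)` (with weak gradient `Du`): the value at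
`u` of the continuous extension, from `W^{1,p}(Ω) ∩ C(closure Ω)` to `W^{1,p}(Ω)`, of the
restriction map `v ↦ v|_∂Ω` into `L^p(∂Ω)`. That is, some `v k` in `W^{1,p}(Ω) ∩ C(closure Ω)`
converge to `u` in `W^{1,p}(Ω)` while their restrictions to `∂Ω` converge to `g` in `L^p(∂Ω)`.
Only the values of `g` on `∂Ω`, up to surface-null sets, matter. -/
def IsTrace {n : ℕ} (Ω : Set (Euc n)) (p : ℝ≥0∞) (u : Euc n → ℝ) (Du : Euc n → Euc n)
    (g : Euc n → ℝ) : Prop :=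
  MemLp g p (surfaceMeasure Ω) ∧
  ∃ (v : ℕ → Euc n → ℝ) (Dv : ℕ → Euc n → Euc n),
    (∀ k, MemW1 Ω p (v k) (Dv k) ∧ ContinuousOn (v k) (closure Ω)) ∧
    Tendsto (fun k => eLpNorm (fun x => v k x - u x) p (volume.restrict Ω)) atTop (𝓝 0) ∧
    Tendsto (fun k => eLpNorm (fun x => Dv k x - Du x) p (volume.restrict Ω)) atTop (𝓝 0) ∧
    Tendsto (fun k => eLpNorm (fun x => v k x - g x) p (surfaceMeasure Ω)) atTop (𝓝 0)

/-- The vector fields `f ∈ C¹(closure Ω ∖ {0}; ℝⁿ) ∩ L^∞(Ω; ℝⁿ)` that solve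
`(x · ∇) f(x) = 0` for `x ∈ Ω ∖ {0}`, and `f(x) = x` for `x ∈ ∂Ω`. -/
structure IsRadialBoundaryField {n : ℕ} (Ω : Set (Euc n)) (f : Euc n → Euc n) : Prop where
  contDiffOn : ContDiffOn ℝ 1 f (closure Ω \ {0})
  memLp_top : MemLp f ∞ (volume.restrict Ω)
  radial : ∀ x ∈ Ω \ {0}, fderiv ℝ f x x = 0
  boundary : ∀ x ∈ frontier Ω, f x = x

/-!
The existence of the field `f` forces the geometry. Along each ray from the origin `f` is constant
inside `Ω` and continuous up to the boundary, so `f x` is the point where the ray through `x`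
leaves `Ω`; continuity of `f` then excludes radial segments in `∂Ω`. Hence `∂Ω` is a `C¹` graph
over the sphere, and `s • closure Ω ⊆ Ω` for `0 < s < 1`
(`IsRadialBoundaryField.exists_exit`, `IsRadialBoundaryField.smul_mem_of_mem_closure`).

For `v` of class `C¹`, the inequality with `v` itself in the place of the trace is, in polar
coordinates, a one-dimensional Hardy inequality on each ray, where `v ∘ f` is the boundary value of
`v`. With `h` the difference, `L r = log (M / r)` and `c = n / (n - 1)`, Young's inequality gives
`(c |h|ⁿ L^{1-n})' ≥ (|h| / L)ⁿ / r - cⁿ |h'|ⁿ rⁿ⁻¹`, and integration gives the constant `cⁿ`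
(`hardy_pointwise`, `hardy_lintegral_domain`). With a constant `M`
larger than the supremum of `|x|`, the integrands stay bounded up to the boundary.

To pass to a general `u`, two facts are needed. First, the surface measure of `∂Ω` is dominated by
the image of Lebesgue measure under `f`, and the cone over a surface-null set is Lebesgue-null. Both
are checked in bi-Lipschitz charts, the central projections of `∂Ω` to the faces of a cube, where
the Hausdorff measure is Lebesgue measure (`exists_surfaceMeasure_le`,
`volume_preimage_eq_zero_of_surface_null`). Second, `C¹` functions are dense: mollify the dilated
function `u (s • x)`, which is defined in a neighbourhood of `closure Ω` (`exists_contDiff_approx`).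

The Hardy weight `|x| log (M / |x|)` being bounded, Hardy's inequality for `C¹` functions bounds
`v ∘ f` in `L^n(Ω)`, hence `v` in `L^n(∂Ω)`, by the Sobolev norm (`exists_trace_estimate`): this is
the trace theorem, and by density the trace of `u` exists. Given any trace `g` of `u`, there are
`C¹` functions converging to `u` in `W^{1,n}(Ω)` and to `g` on `∂Ω`; a subsequence converges almost
everywhere, and Fatou's lemma, applied while the constant in the weight decreases to `M`, gives the
inequality (`hardyQuotient_trace`).
-/

/-! ### Geometry of the domain: rays and the boundary field -/

section Geometry

variable {n : ℕ} {Ω : Set (Euc n)} {f : Euc n → Euc n}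

theorem IsC1Domain.zero_mem (hΩ : IsC1Domain Ω) (hs : StarConvex ℝ 0 Ω) : (0 : Euc n) ∈ Ω :=
  hs.mem hΩ.isConnected.nonempty

theorem IsC1Domain.ne_zero_of_mem_frontier (hΩ : IsC1Domain Ω) (hs : StarConvex ℝ 0 Ω)
    {y : Euc n} (hy : y ∈ frontier Ω) : y ≠ 0 := by
  rintro rfl
  rw [hΩ.isOpen.frontier_eq] at hy
  exact hy.2 (hΩ.zero_mem hs)

theorem smul_mem_of_starConvex_zero (hs : StarConvex ℝ 0 Ω) {x : Euc n} (hx : x ∈ Ω)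
    {s : ℝ} (h0 : 0 ≤ s) (h1 : s ≤ 1) : s • x ∈ Ω :=
  hs.smul_mem hx h0 h1

/-- On the ray through `x ∈ Ω ∖ {0}` the field `f` is constant, equal to the point `t • x` at which
the ray leaves `Ω`. -/
theorem IsRadialBoundaryField.exists_exit (hf : IsRadialBoundaryField Ω f) (hΩ : IsC1Domain Ω)
    (hb : Bornology.IsBounded Ω) (hs : StarConvex ℝ 0 Ω) {x : Euc n} (hx : x ∈ Ω) (hx0 : x ≠ 0) :
    ∃ t : ℝ, 1 < t ∧ t • x ∈ frontier Ω ∧ f x = t • x ∧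
      ∀ s : ℝ, 0 < s → (s • x ∈ Ω ↔ s < t) ∧ (s < t → f (s • x) = t • x) := by
  have hxn : 0 < ‖x‖ := norm_pos_iff.2 hx0
  have hcont : Continuous (fun s : ℝ => s • x) := by fun_prop
  set S : Set ℝ := {s : ℝ | s • x ∈ Ω} with hS
  have hSo : IsOpen S := hΩ.isOpen.preimage hcont
  have h1S : (1 : ℝ) ∈ S := by simpa [hS] using hx
  obtain ⟨B, hB⟩ := hb.exists_norm_le
  have hbdd : BddAbove S := by
    refine ⟨B / ‖x‖, fun s hsS => ?_⟩
    rw [le_div_iff₀ hxn]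
    have := hB _ hsS
    rw [norm_smul, Real.norm_eq_abs] at this
    nlinarith [le_abs_self s]
  set t := sSup S with ht
  have hlt : ∀ s, 0 ≤ s → s < t → s ∈ S := by
    intro s hs0 hst
    obtain ⟨s', hs', hss'⟩ := exists_lt_of_lt_csSup ⟨1, h1S⟩ hst
    have hs'0 : 0 < s' := hs0.trans_lt hss'
    have := smul_mem_of_starConvex_zero hs hs' (s := s / s') (by positivity)
      ((div_le_one hs'0).2 hss'.le)
    rwa [smul_smul, div_mul_cancel₀ _ hs'0.ne'] at this
  have hltS : ∀ s ∈ S, s < t := by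
    intro s hsS
    obtain ⟨e, he, heS⟩ := Metric.isOpen_iff.1 hSo s hsS
    have : s + e / 2 ∈ S := heS (by simp [abs_of_pos he, he])
    have := le_csSup hbdd this
    linarith
  have h1t : 1 < t := hltS 1 h1S
  have htS : t ∉ S := fun h => lt_irrefl t (hltS t h)
  have htcl : t • x ∈ closure Ω := by
    have h2 : t ∈ closure (Set.Ioo 0 t) := by
      rw [closure_Ioo (by linarith)]; exact ⟨by linarith, le_rfl⟩
    exact map_mem_closure (f := fun s : ℝ => s • x) hcont h2 (fun s hsm => hlt s hsm.1.le hsm.2)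
  have htf : t • x ∈ frontier Ω := by
    rw [hΩ.isOpen.frontier_eq]; exact ⟨htcl, htS⟩
  have hne : ∀ s : ℝ, 0 < s → s • x ≠ 0 := fun s h => smul_ne_zero h.ne' hx0
  have hO : IsOpen (Ω \ {0}) := hΩ.isOpen.sdiff isClosed_singleton
  have hder : ∀ s ∈ Set.Ioo 0 t, HasDerivAt (fun s : ℝ => f (s • x)) 0 s := by
    intro s hsm
    have hmem : s • x ∈ Ω \ {0} := ⟨hlt s hsm.1.le hsm.2, hne s hsm.1⟩
    have hd : DifferentiableAt ℝ f (s • x) :=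
      ((hf.contDiffOn.mono (Set.sdiff_subset_sdiff_left subset_closure)).differentiableOn
        one_ne_zero).differentiableAt (hO.mem_nhds hmem)
    have h3 : HasDerivAt (fun s : ℝ => s • x) x s := by
      simpa using (hasDerivAt_id s).smul_const x
    have h4 := hd.hasFDerivAt.comp_hasDerivAt s h3
    have h5 := hf.radial _ hmem
    rw [map_smul, smul_eq_zero] at h5
    rw [h5.resolve_left hsm.1.ne'] at h4
    exact h4
  have hconst : ∀ s ∈ Set.Ioo 0 t, f (s • x) = f x := by
    intro s hsm
    have := isOpen_Ioo.is_const_of_deriv_eq_zero (𝕜 := ℝ) isPreconnected_Ioo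
      (f := fun s : ℝ => f (s • x)) (s := Set.Ioo 0 t)
      (fun s hsm => (hder s hsm).differentiableAt.differentiableWithinAt)
      (fun s hsm => (hder s hsm).deriv) hsm (y := 1) ⟨one_pos, h1t⟩
    simpa using this
  have hfx : f x = t • x := by
    rw [← hf.boundary _ htf]
    have hc : ContinuousWithinAt (fun s : ℝ => f (s • x)) (Set.Ioo 0 t) t := by
      refine ContinuousWithinAt.comp (t := closure Ω \ {0}) (f := fun s : ℝ => s • x) (g := f)
        (hf.contDiffOn.continuousOn _ ⟨htcl, hne t (by linarith)⟩)
        hcont.continuousWithinAt ?_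
      intro s hsm
      exact ⟨subset_closure (hlt s hsm.1.le hsm.2), hne s hsm.1⟩
    have : (𝓝[Set.Ioo 0 t] t).NeBot := by
      rw [← mem_closure_iff_nhdsWithin_neBot, closure_Ioo (by linarith)]
      exact ⟨by linarith, le_rfl⟩
    refine tendsto_nhds_unique ?_ hc
    refine tendsto_const_nhds.congr' ?_
    filter_upwards [self_mem_nhdsWithin] with s hsm using (hconst s hsm).symm
  refine ⟨t, h1t, htf, hfx, fun s hs0 => ⟨⟨fun h => hltS s h, fun h => hlt s hs0.le h⟩, fun h => ?_⟩⟩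
  rw [hconst s ⟨hs0, h⟩, hfx]

theorem IsRadialBoundaryField.continuousOn (hf : IsRadialBoundaryField Ω f) :
    ContinuousOn f (Ω \ {0}) :=
  hf.contDiffOn.continuousOn.mono (Set.sdiff_subset_sdiff_left subset_closure)

/-- Every boundary point is hit transversally: the open segment from `0` to `y ∈ ∂Ω` lies in `Ω`,
and `f` is equal to `y` on it. A radial segment inside `∂Ω` would make `f` discontinuous. -/
theorem IsRadialBoundaryField.smul_mem_of_mem_frontier (hf : IsRadialBoundaryField Ω f)
    (hΩ : IsC1Domain Ω) (hb : Bornology.IsBounded Ω) (hs : StarConvex ℝ 0 Ω) {y : Euc n}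
    (hy : y ∈ frontier Ω) {s : ℝ} (hs0 : 0 < s) (hs1 : s < 1) : s • y ∈ Ω ∧ f (s • y) = y := by
  have hy0 := hΩ.ne_zero_of_mem_frontier hs hy
  obtain ⟨e, he, heΩ⟩ : ∃ e : ℝ, 0 < e ∧ e < 1 ∧ e • y ∈ Ω := by
    have hc : Continuous (fun s : ℝ => s • y) := by fun_prop
    have h0 : ∀ᶠ s in 𝓝[>] (0 : ℝ), s • y ∈ Ω :=
      (hc.tendsto' 0 0 (by simp)).mono_left nhdsWithin_le_nhds
        |>.eventually (hΩ.isOpen.mem_nhds (hΩ.zero_mem hs))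
    have h1 : ∀ᶠ s in 𝓝[>] (0 : ℝ), s < 1 :=
      nhdsWithin_le_nhds (eventually_lt_nhds one_pos)
    obtain ⟨e, h1, h2, h3⟩ := (h0.and (h1.and self_mem_nhdsWithin)).exists
    exact ⟨e, h3, h2, h1⟩
  have hey0 : e • y ≠ 0 := smul_ne_zero he.ne' hy0
  have hfe : f (e • y) = y := by
    -- `f (e • z) = f z` for `z ∈ Ω` near `y`; let `z → y`
    have hcl : y ∈ closure (Ω \ {0}) := by
      have h1 : y ∈ closure Ω := frontier_subset_closure hy
      have h2 : ({0}ᶜ : Set (Euc n)) ∈ 𝓝 y := isOpen_compl_singleton.mem_nhds hy0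
      rw [mem_closure_iff_nhdsWithin_neBot] at h1 ⊢
      rwa [Set.sdiff_eq, nhdsWithin_inter_of_mem' (nhdsWithin_le_nhds h2)]
    have : (𝓝[Ω \ {0}] y).NeBot := mem_closure_iff_nhdsWithin_neBot.1 hcl
    have hO : IsOpen (Ω \ {0}) := hΩ.isOpen.sdiff isClosed_singleton
    have hl1 : Tendsto (fun z => f (e • z)) (𝓝[Ω \ {0}] y) (𝓝 (f (e • y))) := by
      have hfc : ContinuousAt f (e • y) :=
        hf.continuousOn.continuousAt (hO.mem_nhds ⟨heΩ.2, hey0⟩)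
      have : ContinuousAt (fun z => f (e • z)) y :=
        ContinuousAt.comp (g := f) (f := fun z : Euc n => e • z) hfc (by fun_prop)
      exact this.mono_left nhdsWithin_le_nhds
    have hl2 : Tendsto f (𝓝[Ω \ {0}] y) (𝓝 (f y)) :=
      (hf.contDiffOn.continuousOn y ⟨frontier_subset_closure hy, hy0⟩).mono
        (Set.sdiff_subset_sdiff_left subset_closure)
    rw [hf.boundary y hy] at hl2
    refine tendsto_nhds_unique (hl1.congr' ?_) hl2
    filter_upwards [self_mem_nhdsWithin] with z hz
    obtain ⟨t, ht, -, hfz, h⟩ := hf.exists_exit hΩ hb hs hz.1 hz.2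
    rw [hfz, (h e he).2 (by linarith)]
  obtain ⟨t, ht, -, hft, h⟩ := hf.exists_exit hΩ hb hs heΩ.2 hey0
  have hte : t * e = 1 := by
    have h1 : (t * e) • y = (1 : ℝ) • y := by rw [one_smul, ← smul_smul, ← hft, hfe]
    exact smul_left_injective ℝ hy0 h1
  have h2 := h (s / e) (by positivity)
  have h3 : s / e < t := by
    rw [div_lt_iff₀ he]; linarith
  rw [smul_smul, div_mul_cancel₀ _ he.ne'] at h2
  exact ⟨h2.1.2 h3, by rw [h2.2 h3, ← hft, hfe]⟩

theorem IsRadialBoundaryField.apply_smul_of_mem_frontier (hf : IsRadialBoundaryField Ω f)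
    (hΩ : IsC1Domain Ω) (hb : Bornology.IsBounded Ω) (hs : StarConvex ℝ 0 Ω) {y : Euc n}
    (hy : y ∈ frontier Ω) {s : ℝ} (hs0 : 0 < s) (hsy : s • y ∈ Ω) : f (s • y) = y := by
  refine (hf.smul_mem_of_mem_frontier hΩ hb hs hy hs0 ?_).2
  by_contra! h
  have := smul_mem_of_starConvex_zero hs hsy (s := s⁻¹) (by positivity) (inv_le_one_of_one_le₀ h)
  rw [smul_smul, inv_mul_cancel₀ hs0.ne', one_smul] at this
  rw [hΩ.isOpen.frontier_eq] at hy
  exact hy.2 this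

theorem IsRadialBoundaryField.smul_mem_of_mem_closure (hf : IsRadialBoundaryField Ω f)
    (hΩ : IsC1Domain Ω) (hb : Bornology.IsBounded Ω) (hs : StarConvex ℝ 0 Ω) {y : Euc n}
    (hy : y ∈ closure Ω) {s : ℝ} (hs0 : 0 < s) (hs1 : s < 1) : s • y ∈ Ω := by
  by_cases h : y ∈ Ω
  · exact smul_mem_of_starConvex_zero hs h hs0.le hs1.le
  · refine (hf.smul_mem_of_mem_frontier hΩ hb hs ?_ hs0 hs1).1
    rw [hΩ.isOpen.frontier_eq]; exact ⟨hy, h⟩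

end Geometry

/-! ### The one-dimensional Hardy inequality with logarithmic weight -/

section Hardy

/-- Young's inequality with exponents `(m + 1) / m` and `m + 1`. -/
theorem add_one_mul_pow_mul_le (m : ℕ) {a d : ℝ} (ha : 0 ≤ a) (hd : 0 ≤ d) :
    (m + 1) * (a ^ m * d) ≤ m * a ^ (m + 1) + d ^ (m + 1) := by
  induction m with
  | zero => simp
  | succ m ih =>
    have h1 := mul_le_mul_of_nonneg_right ih hd
    have h2 : 0 ≤ (m + 1) * a ^ m * (d - a) ^ 2 := by positivity
    push_cast
    ring_nf at h1 h2 ⊢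
    linarith

theorem hasDerivAt_abs_pow_add_two (k : ℕ) (x : ℝ) :
    HasDerivAt (fun x : ℝ => |x| ^ (k + 2)) ((k + 2) * (|x| ^ k * x)) x := by
  have h := hasDerivAt_abs_rpow x (p := ((k + 2 : ℕ) : ℝ))
    (by push_cast; linarith [k.cast_nonneg (α := ℝ)])
  simp only [Real.rpow_natCast] at h
  convert h using 1
  have : ((k + 2 : ℕ) : ℝ) - 2 = (k : ℝ) := by push_cast; ring
  rw [this, Real.rpow_natCast]
  push_cast; ring

/-- The differential form of the Hardy inequality: `G = c |h|ⁿ L^{1-n}`, `c = n / (n - 1)`, with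
`L r = log (M / r)` and `n = k + 2`, satisfies `G' ≥ (|h| / L)ⁿ / r - cⁿ |h'|ⁿ rⁿ⁻¹`. -/
theorem hardy_pointwise (k : ℕ) {M r h h' : ℝ} {H : ℝ → ℝ} (hr : 0 < r) (hrM : r < M)
    (hh : H r = h) (hH : HasDerivAt H h' r) :
    ∃ G' : ℝ, HasDerivAt
        (fun r => (k + 2) / (k + 1) * (|H r| ^ (k + 2) * (Real.log (M / r) ^ (k + 1))⁻¹)) G' r ∧
      r ^ (k + 1) * |h / (r * Real.log (M / r))| ^ (k + 2)
        - r ^ (k + 1) * ((k + 2) / (k + 1) * |h'|) ^ (k + 2) ≤ G' := by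
  have hM : 0 < M := hr.trans hrM
  have hL : 0 < Real.log (M / r) := Real.log_pos ((one_lt_div hr).2 hrM)
  set L := Real.log (M / r) with hLdef
  have hdL : HasDerivAt (fun r => Real.log (M / r)) (-(1 / r)) r := by
    have h1 : HasDerivAt (fun r : ℝ => M / r) (-(M / r ^ 2)) r := by
      have := (hasDerivAt_inv hr.ne').const_mul M
      simpa [div_eq_mul_inv] using this
    convert h1.log (by positivity) using 1
    field_simp
  have hd1 := (hasDerivAt_abs_pow_add_two k (H r)).comp r hH
  have hd2 := (hdL.pow (k + 1)).inv (pow_ne_zero _ hL.ne')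
  have hd3 := (hd1.mul hd2).const_mul (((k : ℝ) + 2) / (k + 1))
  refine ⟨_, hd3, ?_⟩
  simp only [Pi.pow_apply, Pi.inv_apply, Function.comp_apply, hh, ← hLdef, Nat.add_sub_cancel]
  set A := |h| / L with hA
  have hA0 : 0 ≤ A := by positivity
  set D := (k + 2) / (k + 1) * |h'| * r with hD
  have hD0 : 0 ≤ D := by positivity
  have hY := add_one_mul_pow_mul_le (k + 1) hA0 hD0
  have e1 : r ^ (k + 1) * |h / (r * L)| ^ (k + 2) = A ^ (k + 2) / r := by
    rw [abs_div, abs_mul, abs_of_pos hr, abs_of_pos hL, hA, div_pow, div_pow, mul_pow]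
    field_simp
    ring
  have e2 : r ^ (k + 1) * ((k + 2) / (k + 1) * |h'|) ^ (k + 2) = D ^ (k + 2) / r := by
    simp only [hD, mul_pow]; field_simp; ring
  have e3 : |h| = A * L := by rw [hA]; field_simp
  rw [e1, e2]
  have hhh' : -(|h| * |h'|) ≤ h * h' := by
    rw [← abs_mul]; exact neg_abs_le _
  have key : (k + 2) / (k + 1) * ((k + 2) * (|h| ^ k * h) * h' * (L ^ (k + 1))⁻¹) ≥
      - ((k + 2) * (A ^ (k + 1) * D) / r) := by
    have : (k + 2) * (A ^ (k + 1) * D) / r =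
        (k + 2) / (k + 1) * ((k + 2) * (|h| ^ k * (L ^ (k + 1))⁻¹)) * (|h| * |h'|) := by
      simp only [hD, e3, mul_pow]; field_simp; ring
    rw [this, ge_iff_le, ← mul_neg]
    calc _ ≤ (k + 2) / (k + 1) * ((k + 2) * (|h| ^ k * (L ^ (k + 1))⁻¹)) * (h * h') :=
          mul_le_mul_of_nonneg_left hhh' (by positivity)
      _ = _ := by ring
  have e4 : (k + 2) / (k + 1) *
      (|h| ^ (k + 2) * (-(((k + 1 : ℕ) : ℝ) * L ^ k * -(1 / r)) / (L ^ (k + 1)) ^ 2)) =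
      (k + 2) * A ^ (k + 2) / r := by
    simp only [e3, mul_pow]; push_cast; field_simp; ring
  rw [mul_add, e4]
  have hY2 : (k + 2) * (A ^ (k + 1) * D) / r ≤ ((k + 1) * A ^ (k + 2) + D ^ (k + 2)) / r := by
    gcongr
    push_cast at hY
    ring_nf at hY ⊢
    linarith
  have e5 : ((k + 2) * A ^ (k + 2) / r) - ((k + 1) * A ^ (k + 2) + D ^ (k + 2)) / r =
    A ^ (k + 2) / r - D ^ (k + 2) / r := by ring
  linarith

/-- Hardy's inequality on `[a, R]`. The integrand is bounded there, as `R < M`. -/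
theorem hardy_interval (k : ℕ) {M a R : ℝ} {φ φ' : ℝ → ℝ} (ha : 0 < a) (haR : a ≤ R) (hRM : R < M)
    (hφ : ∀ r, HasDerivAt φ (φ' r) r) (hφ' : Continuous φ') :
    ∫ r in a..R, r ^ (k + 1) * |(φ r - φ R) / (r * Real.log (M / r))| ^ (k + 2) ≤
      ∫ r in a..R, r ^ (k + 1) * ((k + 2) / (k + 1) * |φ' r|) ^ (k + 2) := by
  have hM : 0 < M := by linarith
  have hφc : Continuous φ := continuous_iff_continuousAt.2 fun r => (hφ r).continuousAt
  have hLpos : ∀ r ∈ Set.Icc a R, 0 < Real.log (M / r) := fun r hr =>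
    Real.log_pos ((one_lt_div (ha.trans_le hr.1)).2 (hr.2.trans_lt hRM))
  have hLc : ContinuousOn (fun r => Real.log (M / r)) (Set.Icc a R) := by
    refine ContinuousOn.log (continuousOn_const.div continuousOn_id fun r hr => ?_) fun r hr => ?_
    · exact (ha.trans_le hr.1).ne'
    · exact (div_pos hM (ha.trans_le hr.1)).ne'
  have hc1 : ContinuousOn
      (fun r => r ^ (k + 1) * |(φ r - φ R) / (r * Real.log (M / r))| ^ (k + 2)) (Set.Icc a R) := by
    refine (continuousOn_id.pow _).mul (((ContinuousOn.div (by fun_prop)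
      (continuousOn_id.mul hLc) fun r hr => ?_).abs).pow _)
    exact (mul_pos (ha.trans_le hr.1) (hLpos r hr)).ne'
  have hc2 : Continuous (fun r => r ^ (k + 1) * ((k + 2) / (k + 1) * |φ' r|) ^ (k + 2)) := by
    fun_prop
  have hi1 := hc1.intervalIntegrable_of_Icc (μ := volume) haR
  have hi2 := hc2.intervalIntegrable (μ := volume) a R
  have hmain := fun r (hr : r ∈ Set.Icc a R) => hardy_pointwise k (M := M) (r := r)
    (H := fun r => φ r - φ R) (h' := φ' r) (ha.trans_le hr.1) (hr.2.trans_lt hRM) rfl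
    ((hφ r).sub_const _)
  choose! G' hG' hle using hmain
  have := intervalIntegral.integral_le_sub_of_hasDeriv_right_of_le haR
    (fun r hr => (hG' r hr).continuousAt.continuousWithinAt)
    (fun r hr => (hG' r (Set.Ioo_subset_Icc_self hr)).hasDerivWithinAt)
    (hc1.sub hc2.continuousOn).integrableOn_Icc
    (fun r hr => hle r (Set.Ioo_subset_Icc_self hr))
  simp only [Pi.sub_apply] at this
  rw [intervalIntegral.integral_sub hi1 hi2] at this
  have h0 : 0 ≤ (k + 2) / (k + 1) * (|φ a - φ R| ^ (k + 2) * (Real.log (M / a) ^ (k + 1))⁻¹) := by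
    have := hLpos a ⟨le_rfl, haR⟩
    positivity
  simp only [sub_self, abs_zero, zero_pow (Nat.succ_ne_zero _), zero_mul, mul_zero] at this
  linarith

theorem hardy_lintegral (k : ℕ) {M R : ℝ} {φ φ' : ℝ → ℝ} (hRM : R < M)
    (hφ : ∀ r, HasDerivAt φ (φ' r) r) (hφ' : Continuous φ') :
    ∫⁻ r in Set.Ioo 0 R, ENNReal.ofReal (r ^ (k + 1)) *
        ‖(φ r - φ R) / (r * Real.log (M / r))‖ₑ ^ (k + 2) ≤
      ∫⁻ r in Set.Ioo 0 R, ENNReal.ofReal (r ^ (k + 1)) *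
        ‖(k + 2) / (k + 1) * φ' r‖ₑ ^ (k + 2) := by
  have hφc : Continuous φ := continuous_iff_continuousAt.2 fun r => (hφ r).continuousAt
  have e1 : ∀ r ∈ Set.Ioo 0 R, ∀ y : ℝ, ENNReal.ofReal (r ^ (k + 1)) * ‖y‖ₑ ^ (k + 2) =
      ENNReal.ofReal (r ^ (k + 1) * |y| ^ (k + 2)) := by
    intro r hr y
    rw [ENNReal.ofReal_mul (pow_nonneg hr.1.le _), ENNReal.ofReal_pow (abs_nonneg _),
      Real.enorm_eq_ofReal_abs]
  have hU : Set.Ioo 0 R = ⋃ j : ℕ, Set.Ioo (1 / ((j : ℝ) + 1)) R := by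
    ext r
    simp only [Set.mem_Ioo, Set.mem_iUnion]
    refine ⟨fun h => ?_, fun ⟨j, hj⟩ => ⟨lt_trans (by positivity) hj.1, hj.2⟩⟩
    obtain ⟨j, hj⟩ := exists_nat_one_div_lt h.1
    exact ⟨j, hj, h.2⟩
  have hdir : Directed (fun x1 x2 => x1 ⊆ x2) (fun j : ℕ => Set.Ioo (1 / ((j : ℝ) + 1)) R) := by
    refine Monotone.directed_le fun i j hij => Set.Ioo_subset_Ioo_left ?_
    have : (i : ℝ) ≤ j := by exact_mod_cast hij
    gcongr
  conv_lhs => rw [hU]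
  rw [setLIntegral_iUnion_of_directed _ hdir]
  refine iSup_le fun j => ?_
  set a := 1 / ((j : ℝ) + 1) with ha
  have ha0 : 0 < a := by positivity
  by_cases haR : a ≤ R
  swap
  · rw [Set.Ioo_eq_empty (fun h => haR h.le)]; simp
  have hsub : Set.Ioo a R ⊆ Set.Ioo 0 R := Set.Ioo_subset_Ioo_left ha0.le
  refine le_trans ?_ (lintegral_mono_set hsub)
  rw [setLIntegral_congr_fun measurableSet_Ioo (fun r hr => e1 r (hsub hr) _),
    setLIntegral_congr_fun measurableSet_Ioo (fun r hr => e1 r (hsub hr) _)]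
  have hc : ((k : ℝ) + 2) / (k + 1) = |((k : ℝ) + 2) / (k + 1)| := by
    rw [abs_of_pos (by positivity)]
  have hI := hardy_interval k ha0 haR hRM hφ hφ'
  rw [intervalIntegral.integral_of_le haR, intervalIntegral.integral_of_le haR,
    integral_Ioc_eq_integral_Ioo, integral_Ioc_eq_integral_Ioo] at hI
  have hM : 0 < M := by linarith
  have hi1 : IntegrableOn
      (fun r => r ^ (k + 1) * |(φ r - φ R) / (r * Real.log (M / r))| ^ (k + 2)) (Set.Ioo a R) := by
    refine IntegrableOn.mono_set (ContinuousOn.integrableOn_Icc (a := a) (b := R) ?_)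
      Set.Ioo_subset_Icc_self
    have hLc : ContinuousOn (fun r => Real.log (M / r)) (Set.Icc a R) := by
      refine ContinuousOn.log (continuousOn_const.div continuousOn_id fun r hr => ?_) fun r hr => ?_
      · exact (ha0.trans_le hr.1).ne'
      · exact (div_pos hM (ha0.trans_le hr.1)).ne'
    refine (continuousOn_id.pow _).mul (((ContinuousOn.div (by fun_prop)
      (continuousOn_id.mul hLc) fun r hr => ?_).abs).pow _)
    exact (mul_pos (ha0.trans_le hr.1) (Real.log_pos
      ((one_lt_div (ha0.trans_le hr.1)).2 (hr.2.trans_lt hRM)))).ne'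
  have hi2 : IntegrableOn
      (fun r => r ^ (k + 1) * |(k + 2) / (k + 1) * φ' r| ^ (k + 2)) (Set.Ioo a R) := by
    refine IntegrableOn.mono_set (Continuous.integrableOn_Icc (a := a) (b := R) ?_)
      Set.Ioo_subset_Icc_self
    fun_prop
  rw [← ofReal_integral_eq_lintegral_ofReal hi1, ← ofReal_integral_eq_lintegral_ofReal hi2]
  · refine ENNReal.ofReal_le_ofReal (hI.trans (le_of_eq ?_))
    refine setIntegral_congr_fun measurableSet_Ioo fun r _ => ?_
    simp only [abs_mul, ← hc]
  · filter_upwards [ae_restrict_mem measurableSet_Ioo] with r hr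
    have := ha0.trans hr.1
    simp only [Pi.zero_apply]; positivity
  · filter_upwards [ae_restrict_mem measurableSet_Ioo] with r hr
    have := ha0.trans hr.1
    simp only [Pi.zero_apply]; positivity

end Hardy

/-! ### Polar coordinates and the Hardy inequality for smooth functions -/

section Polar

variable {n : ℕ}

theorem lintegral_eq_lintegral_polar_prod [Nonempty (Fin n)] (G : Euc n → ℝ≥0∞) :
    ∫⁻ x, G x = ∫⁻ p : Metric.sphere (0 : Euc n) 1 × Set.Ioi (0 : ℝ), G ((p.2 : ℝ) • (p.1 : Euc n))
      ∂((volume : Measure (Euc n)).toSphere.prod (Measure.volumeIoiPow (n - 1))) := by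
  have hmp := (volume : Measure (Euc n)).measurePreserving_homeomorphUnitSphereProd
  rw [finrank_euclideanSpace_fin] at hmp
  rw [← hmp.lintegral_comp_emb (homeomorphUnitSphereProd (Euc n)).measurableEmbedding]
  have h1 : ∀ x : ({0}ᶜ : Set (Euc n)),
      (((homeomorphUnitSphereProd (Euc n)) x).2 : ℝ) •
        (((homeomorphUnitSphereProd (Euc n)) x).1 : Euc n) = x := by
    intro x
    rw [← homeomorphUnitSphereProd_symm_apply_coe, Homeomorph.symm_apply_apply]
  simp only [h1]
  rw [lintegral_subtype_comap (measurableSet_singleton _).compl G, restrict_compl_singleton]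

theorem lintegral_fun_volumeIoiPow (m : ℕ) (F : ℝ → ℝ≥0∞) :
    ∫⁻ r : Set.Ioi (0 : ℝ), F r ∂(Measure.volumeIoiPow m) =
      ∫⁻ r in Set.Ioi (0 : ℝ), ENNReal.ofReal (r ^ m) * F r := by
  rw [Measure.volumeIoiPow, lintegral_withDensity_eq_lintegral_mul_non_measurable _ (by fun_prop)
    (by simp)]
  exact lintegral_subtype_comap measurableSet_Ioi (fun r => ENNReal.ofReal (r ^ m) * F r)

/-- A version of integration in polar coordinates that does not need measurability. -/
theorem lintegral_polar_le (G : Euc n → ℝ≥0∞) (hn : 1 ≤ n) :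
    ∫⁻ x, G x ≤ ∫⁻ θ : Metric.sphere (0 : Euc n) 1, (∫⁻ r in Set.Ioi (0 : ℝ),
      ENNReal.ofReal (r ^ (n - 1)) * G (r • (θ : Euc n))) ∂(volume : Measure (Euc n)).toSphere := by
  have : Nonempty (Fin n) := ⟨⟨0, hn⟩⟩
  rw [lintegral_eq_lintegral_polar_prod]
  refine (lintegral_prod_le _).trans (lintegral_mono fun θ => le_of_eq ?_)
  exact lintegral_fun_volumeIoiPow (n - 1) (fun r => G (r • (θ : Euc n)))

theorem lintegral_polar {G : Euc n → ℝ≥0∞} (hn : 1 ≤ n) (hG : Measurable G) :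
    ∫⁻ x, G x = ∫⁻ θ : Metric.sphere (0 : Euc n) 1, (∫⁻ r in Set.Ioi (0 : ℝ),
      ENNReal.ofReal (r ^ (n - 1)) * G (r • (θ : Euc n))) ∂(volume : Measure (Euc n)).toSphere := by
  have : Nonempty (Fin n) := ⟨⟨0, hn⟩⟩
  rw [lintegral_eq_lintegral_polar_prod, lintegral_prod _ (by fun_prop)]
  refine lintegral_congr fun θ => ?_
  exact lintegral_fun_volumeIoiPow (n - 1) (fun r => G (r • (θ : Euc n)))

/-- **Hardy's inequality for `C¹` functions**: the one-dimensional inequality on almost every ray.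
The constant `M` in the logarithm exceeds the norms on `Ω`, so that the weight stays bounded up to
the boundary. -/
theorem hardy_lintegral_domain {k : ℕ} {Ω : Set (Euc (k + 2))} {f : Euc (k + 2) → Euc (k + 2)}
    (hf : IsRadialBoundaryField Ω f) (hΩ : IsC1Domain Ω)
    (hb : Bornology.IsBounded Ω) (hs : StarConvex ℝ 0 Ω) {M : ℝ} (hM : ∀ x ∈ closure Ω, ‖x‖ < M)
    {v : Euc (k + 2) → ℝ} (hv : ContDiff ℝ 1 v) :
    ∫⁻ x in Ω, ‖(v x - v (f x)) / (‖x‖ * Real.log (M / ‖x‖))‖ₑ ^ (k + 2) ≤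
      ∫⁻ x in Ω, ‖(k + 2) / (k + 1) * fderiv ℝ v x (‖x‖⁻¹ • x)‖ₑ ^ (k + 2) := by
  have hΩm : MeasurableSet Ω := hΩ.isOpen.measurableSet
  have hfd : Continuous (fun x => fderiv ℝ v x) := hv.continuous_fderiv one_ne_zero
  have hmeas : Measurable (fun x : Euc (k + 2) =>
      ‖((k : ℝ) + 2) / (k + 1) * fderiv ℝ v x (‖x‖⁻¹ • x)‖ₑ ^ (k + 2)) := by
    have h1 : Measurable (fun x : Euc (k + 2) => fderiv ℝ v x (‖x‖⁻¹ • x)) := by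
      have : (fun x : Euc (k + 2) => fderiv ℝ v x (‖x‖⁻¹ • x)) =
          fun x => ‖x‖⁻¹ * fderiv ℝ v x x := by ext x; simp
      rw [this]
      exact measurable_norm.inv.mul (hfd.clm_apply continuous_id).measurable
    exact (h1.const_mul _).enorm.pow_const _
  rw [← lintegral_indicator hΩm, ← lintegral_indicator hΩm,
    lintegral_polar (by omega) (hmeas.indicator hΩm)]
  refine (lintegral_polar_le _ (by omega)).trans ?_
  refine lintegral_mono fun θ => ?_
  have hθ : ‖(θ : Euc (k + 2))‖ = 1 := by simp
  have hθ0 : (θ : Euc (k + 2)) ≠ 0 := norm_ne_zero_iff.1 (by rw [hθ]; exact one_ne_zero)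
  obtain ⟨e, he, heΩ⟩ : ∃ e : ℝ, 0 < e ∧ e • (θ : Euc (k + 2)) ∈ Ω := by
    have hc : Continuous (fun s : ℝ => s • (θ : Euc (k + 2))) := by fun_prop
    have h0 : ∀ᶠ s in 𝓝[>] (0 : ℝ), s • (θ : Euc (k + 2)) ∈ Ω :=
      (hc.tendsto' 0 0 (by simp)).mono_left nhdsWithin_le_nhds
        |>.eventually (hΩ.isOpen.mem_nhds (hΩ.zero_mem hs))
    obtain ⟨e, h1, h2⟩ := (h0.and self_mem_nhdsWithin).exists
    exact ⟨e, h2, h1⟩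
  obtain ⟨t, ht, hfr, -, hray⟩ := hf.exists_exit hΩ hb hs heΩ (smul_ne_zero he.ne' hθ0)
  set R := t * e with hR
  have hR0 : 0 < R := by positivity
  rw [smul_smul] at hfr
  have hRM : R < M := by
    have := hM _ (frontier_subset_closure hfr)
    rwa [norm_smul, hθ, mul_one, Real.norm_eq_abs, abs_of_pos hR0] at this
  have hray' : ∀ r : ℝ, 0 < r → (r • (θ : Euc (k + 2)) ∈ Ω ↔ r < R) ∧
      (r < R → f (r • (θ : Euc (k + 2))) = R • (θ : Euc (k + 2))) := by
    intro r hr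
    have h := hray (r / e) (by positivity)
    rw [smul_smul, div_mul_cancel₀ _ he.ne', div_lt_iff₀ he, smul_smul] at h
    exact h
  have key := hardy_lintegral k hRM (φ := fun r => v (r • (θ : Euc (k + 2))))
    (φ' := fun r => fderiv ℝ v (r • (θ : Euc (k + 2))) θ) (fun r => by
      have h3 : HasDerivAt (fun s : ℝ => s • (θ : Euc (k + 2))) (θ : Euc (k + 2)) r := by
        simpa using (hasDerivAt_id r).smul_const (θ : Euc (k + 2))
      exact ((hv.differentiable one_ne_zero) _).hasFDerivAt.comp_hasDerivAt r h3)
    (by exact (hfd.comp (by fun_prop)).clm_apply continuous_const)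
  have hsplit : ∀ F : Euc (k + 2) → ℝ≥0∞,
      ∫⁻ r in Set.Ioi (0 : ℝ), ENNReal.ofReal (r ^ (k + 2 - 1)) *
        Ω.indicator F (r • (θ : Euc (k + 2))) =
      ∫⁻ r in Set.Ioo 0 R, ENNReal.ofReal (r ^ (k + 1)) * F (r • (θ : Euc (k + 2))) := by
    intro F
    rw [← lintegral_indicator measurableSet_Ioi, ← lintegral_indicator measurableSet_Ioo]
    refine lintegral_congr fun r => ?_
    by_cases hr : 0 < r
    · by_cases hrR : r < R
      · rw [Set.indicator_of_mem (Set.mem_Ioi.2 hr), Set.indicator_of_mem (Set.mem_Ioo.2 ⟨hr, hrR⟩),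
          Set.indicator_of_mem ((hray' r hr).1.2 hrR)]
        rfl
      · rw [Set.indicator_of_mem (Set.mem_Ioi.2 hr),
          Set.indicator_of_notMem (fun h : r ∈ Set.Ioo 0 R => hrR h.2),
          Set.indicator_of_notMem (s := Ω) (fun h => hrR ((hray' r hr).1.1 h)), mul_zero]
    · rw [Set.indicator_of_notMem (fun h : r ∈ Set.Ioi 0 => hr h),
        Set.indicator_of_notMem (fun h : r ∈ Set.Ioo 0 R => hr h.1)]
  rw [hsplit, hsplit]
  have hn : ∀ r ∈ Set.Ioo 0 R, ‖r • (θ : Euc (k + 2))‖ = r := fun r hr => by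
    rw [norm_smul, hθ, mul_one, Real.norm_eq_abs, abs_of_pos hr.1]
  refine le_trans (le_of_eq ?_) (key.trans (le_of_eq ?_))
  · refine setLIntegral_congr_fun measurableSet_Ioo fun r hr => ?_
    simp only [hn r hr, (hray' r hr.1).2 hr.2]
  · refine setLIntegral_congr_fun measurableSet_Ioo fun r hr => ?_
    simp only [hn r hr]
    rw [smul_smul, inv_mul_cancel₀ hr.1.ne', one_smul]

end Polar

/-! ### Comparing the surface measure with Lebesgue measure on the cone over the boundary -/

section Surface

variable {m : ℕ}

/-- The face coordinates `x_j / x_i`, `j ≠ i`: the central projection to the hyperplane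
`x_i = 1`. -/
noncomputable def faceCoord (i : Fin (m + 1)) (x : Euc (m + 1)) : Fin m → ℝ :=
  fun j => x (i.succAbove j) / x i

/-- The point of the hyperplane `x_i = 1` with given remaining coordinates; a section of `faceCoord`. -/
noncomputable def faceCoordInv (i : Fin (m + 1)) (y : Fin m → ℝ) : Euc (m + 1) :=
  WithLp.toLp 2 (i.insertNth (1 : ℝ) y)

/-- The cone over the face `x_i = κ` of the cube `[-1, 1]ⁿ`, for `κ = ±1`. -/
def faceCone (i : Fin (m + 1)) (κ : ℝ) : Set (Euc (m + 1)) :=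
  {x | 0 < κ * x i ∧ ∀ j, |x j| ≤ |x i|}

theorem smul_faceCoordInv_faceCoord {i : Fin (m + 1)} {x : Euc (m + 1)} (hx : x i ≠ 0) :
    x i • faceCoordInv i (faceCoord i x) = x := by
  ext j
  refine Fin.succAboveCases i ?_ (fun j => ?_) j
  · simp [faceCoordInv]
  · simp [faceCoordInv, faceCoord]; field_simp

theorem faceCoord_smul (i : Fin (m + 1)) {t : ℝ} (ht : t ≠ 0) (x : Euc (m + 1)) :
    faceCoord i (t • x) = faceCoord i x := by
  ext j
  simp [faceCoord, mul_div_mul_left _ _ ht]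

theorem contDiff_faceCoordInv (i : Fin (m + 1)) : ContDiff ℝ 1 (faceCoordInv (m := m) i) := by
  rw [contDiff_euclidean]
  intro j
  refine Fin.succAboveCases i ?_ (fun j => ?_) j
  · simp only [faceCoordInv, Fin.insertNth_apply_same]; exact contDiff_const
  · simp only [faceCoordInv, Fin.insertNth_apply_succAbove]; exact contDiff_apply ℝ ℝ j

theorem faceCoordInv_ne_zero (i : Fin (m + 1)) (y : Fin m → ℝ) : faceCoordInv i y ≠ 0 := by
  intro h
  have := congrArg (fun z : Euc (m + 1) => z i) h
  simp [faceCoordInv] at this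

theorem exists_mem_faceCone {x : Euc (m + 1)} (hx : x ≠ 0) :
    ∃ i, x ∈ faceCone i 1 ∪ faceCone i (-1) := by
  obtain ⟨i, hi⟩ := Finite.exists_max (fun i => |x i|)
  have hi0 : x i ≠ 0 := by
    intro h0
    refine hx (PiLp.ext fun j => ?_)
    have := hi j
    rw [h0, abs_zero] at this
    simpa using this
  refine ⟨i, ?_⟩
  rcases hi0.lt_or_gt with h | h
  · exact Or.inr ⟨by linarith, hi⟩
  · exact Or.inl ⟨by linarith, hi⟩

theorem faceCone_ne_zero {i : Fin (m + 1)} {κ : ℝ} {x : Euc (m + 1)} (hx : x ∈ faceCone i κ) :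
    x i ≠ 0 := fun h => by
  have := hx.1
  rw [h, mul_zero] at this
  exact lt_irrefl _ this

theorem faceCoord_mem_Icc {i : Fin (m + 1)} {κ : ℝ} {x : Euc (m + 1)} (hx : x ∈ faceCone i κ) :
    faceCoord i x ∈ Set.Icc (-1 : Fin m → ℝ) 1 := by
  have h0 : 0 < |x i| := abs_pos.2 (faceCone_ne_zero hx)
  have : ∀ j, |faceCoord i x j| ≤ 1 := fun j => by
    rw [faceCoord, abs_div, div_le_one h0]; exact hx.2 _
  exact ⟨fun j => (abs_le.1 (this j)).1, fun j => (abs_le.1 (this j)).2⟩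

/-- Lebesgue measure in face coordinates (Fubini): the slice `x_i = s` of the set is `s • B`. -/
theorem volume_faceCoord_preimage (i : Fin (m + 1)) {I : Set ℝ} (hI : MeasurableSet I)
    {B : Set (Fin m → ℝ)} (hB : MeasurableSet B) :
    volume {x : Euc (m + 1) | x i ∈ I ∧ faceCoord i x ∈ B} =
      (∫⁻ s in I, ENNReal.ofReal (|s| ^ m)) * volume B := by
  have hmp := (volume_preserving_piFinSuccAbove (fun _ : Fin (m + 1) => ℝ) i).comp
    (PiLp.volume_preserving_ofLp (Fin (m + 1)))
  set T : Set (ℝ × (Fin m → ℝ)) := {p | p.1 ∈ I ∧ (fun j => p.2 j / p.1) ∈ B} with hT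
  have hTm : MeasurableSet T := by
    refine (measurable_fst hI).inter ?_
    have : Measurable (fun p : ℝ × (Fin m → ℝ) => fun j => p.2 j / p.1) := by fun_prop
    exact this hB
  have hpre : {x : Euc (m + 1) | x i ∈ I ∧ faceCoord i x ∈ B} =
      (⇑(MeasurableEquiv.piFinSuccAbove (fun _ : Fin (m + 1) => ℝ) i) ∘
        (WithLp.ofLp : Euc (m + 1) → Fin (m + 1) → ℝ)) ⁻¹' T := by
    ext x
    rfl
  rw [hpre, hmp.measure_preimage hTm.nullMeasurableSet]
  change ((volume : Measure ℝ).prod (volume : Measure (Fin m → ℝ))) T = _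
  rw [Measure.prod_apply hTm, ← lintegral_mul_const _ (by fun_prop), ← lintegral_indicator hI]
  have h0 : ∀ᵐ s : ℝ, s ≠ 0 := by simp [ae_iff]
  refine lintegral_congr_ae ?_
  filter_upwards [h0] with s hs
  by_cases hsI : s ∈ I
  · rw [Set.indicator_of_mem hsI]
    have : Prod.mk s ⁻¹' T = (fun z : Fin m → ℝ => s⁻¹ • z) ⁻¹' B := by
      ext z
      simp only [hT, Set.mem_preimage, Set.mem_ofPred_eq, hsI, true_and]
      have : (fun j => z j / s) = s⁻¹ • z := by ext j; simp [div_eq_inv_mul]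
      rw [this]
    rw [this, Measure.addHaar_preimage_smul _ (inv_ne_zero hs)]
    simp
  · rw [Set.indicator_of_notMem hsI]
    have : Prod.mk s ⁻¹' T = ∅ := by
      ext z; simp [hT, hsI]
    rw [this, measure_empty]

theorem volume_faceCoord_preimage_eq_zero (i : Fin (m + 1)) {B : Set (Fin m → ℝ)}
    (hB : volume B = 0) : volume {x : Euc (m + 1) | faceCoord i x ∈ B} = 0 := by
  refine measure_mono_null (t := {x : Euc (m + 1) | x i ∈ Set.univ ∧
    faceCoord i x ∈ toMeasurable volume B}) (fun x hx => ⟨trivial, subset_toMeasurable _ _ hx⟩) ?_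
  rw [volume_faceCoord_preimage i MeasurableSet.univ (measurableSet_toMeasurable _ _),
    measure_toMeasurable, hB, mul_zero]

theorem lipschitzOnWith_faceCoord (i : Fin (m + 1)) (κ : ℝ) {η : ℝ} (hη : 0 < η) :
    LipschitzOnWith (2 / η).toNNReal (faceCoord i) (faceCone i κ ∩ {x | η ≤ |x i|}) := by
  refine LipschitzOnWith.of_dist_le_mul fun x hx z hz => ?_
  rw [Real.coe_toNNReal _ (by positivity)]
  refine (dist_pi_le_iff (by positivity)).2 fun j => ?_
  have hx0 := faceCone_ne_zero hx.1
  have hz0 := faceCone_ne_zero hz.1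
  have hc : ∀ l, |x l - z l| ≤ dist x z := fun l => by
    rw [← Real.dist_eq]; exact PiLp.dist_apply_le x z l
  set l := i.succAbove j with hl
  have e : faceCoord i x j - faceCoord i z j = ((x l - z l) - z l / z i * (x i - z i)) / x i := by
    simp only [faceCoord, ← hl]; field_simp; ring
  rw [Real.dist_eq, e, abs_div, div_le_iff₀ (abs_pos.2 hx0)]
  have h1 : |z l / z i| ≤ 1 := by
    rw [abs_div, div_le_one (abs_pos.2 hz0)]; exact hz.1.2 l
  have h2 : |(x l - z l) - z l / z i * (x i - z i)| ≤ 2 * dist x z := by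
    refine (abs_sub _ _).trans ?_
    rw [abs_mul]
    have := mul_le_mul h1 (hc i) (abs_nonneg _) zero_le_one
    linarith [hc l]
  have h3 : 2 * dist x z = 2 / η * dist x z * η := by field_simp
  have h4 := mul_le_mul_of_nonneg_left hx.2 (show 0 ≤ 2 / η * dist x z by positivity)
  linarith

theorem hausdorffMeasure_fin_pi (m : ℕ) :
    (Measure.hausdorffMeasure (m : ℝ) : Measure (Fin m → ℝ)) = volume := by
  simpa using hausdorffMeasure_pi_real (ι := Fin m)

variable {Ω : Set (Euc (m + 1))} {f : Euc (m + 1) → Euc (m + 1)}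

/-- On one face, `faceCoord` is Lipschitz on `∂Ω`, hence maps a null set to a null set, and the cone
over a null set of coordinates is null by Fubini. -/
theorem surface_null_faceCone (hf : IsRadialBoundaryField Ω f) (hΩ : IsC1Domain Ω)
    (hb : Bornology.IsBounded Ω) (hs : StarConvex ℝ 0 Ω) (i : Fin (m + 1)) (κ : ℝ)
    {N : Set (Euc (m + 1))} (hN : Measure.hausdorffMeasure (m : ℝ) (N ∩ frontier Ω) = 0) :
    volume ((Ω \ {0}) ∩ f ⁻¹' N ∩ faceCone i κ) = 0 := by
  obtain ⟨ρ, hρ, hball⟩ := Metric.isOpen_iff.1 hΩ.isOpen 0 (hΩ.zero_mem hs)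
  set η := ρ / (m + 1) with hη
  have hη0 : 0 < η := by positivity
  have hfr : ∀ x ∈ frontier Ω ∩ faceCone i κ, η ≤ |x i| := by
    intro x hx
    by_contra! hlt
    have hxΩ : x ∉ Ω := by
      have := hx.1; rw [hΩ.isOpen.frontier_eq] at this; exact this.2
    refine hxΩ (hball ?_)
    rw [mem_ball_zero_iff, EuclideanSpace.norm_eq, Real.sqrt_lt' hρ]
    calc ∑ j, ‖x j‖ ^ 2 ≤ ∑ j : Fin (m + 1), |x i| ^ 2 :=
          Finset.sum_le_sum fun j _ => pow_le_pow_left₀ (norm_nonneg _) (hx.2.2 j) 2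
      _ = (m + 1) * |x i| ^ 2 := by simp
      _ < (m + 1) * η ^ 2 := by gcongr
      _ ≤ ((m + 1) * η) ^ 2 := by
          rw [mul_pow]
          gcongr
          nlinarith [(m.cast_nonneg : (0 : ℝ) ≤ m)]
      _ = ρ ^ 2 := by rw [hη]; field_simp
  have hnull : volume (faceCoord i '' (N ∩ frontier Ω ∩ faceCone i κ)) = 0 := by
    have hL := (lipschitzOnWith_faceCoord i κ hη0).mono (s := N ∩ frontier Ω ∩ faceCone i κ)
      (fun x hx => ⟨hx.2, hfr x ⟨hx.1.2, hx.2⟩⟩)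
    have h1 := hL.hausdorffMeasure_image_le (d := (m : ℝ)) (by positivity)
    rw [measure_mono_null Set.inter_subset_left hN, mul_zero, hausdorffMeasure_fin_pi] at h1
    exact le_antisymm h1 zero_le
  refine measure_mono_null ?_ (volume_faceCoord_preimage_eq_zero i hnull)
  rintro x ⟨⟨⟨hx, hx0⟩, hfN⟩, hK⟩
  obtain ⟨t, ht, htf, hfx, -⟩ := hf.exists_exit hΩ hb hs hx hx0
  have ht0 : 0 < t := by linarith
  refine ⟨t • x, ⟨⟨hfx ▸ hfN, htf⟩, ⟨?_, fun j => ?_⟩⟩, faceCoord_smul i ht0.ne' x⟩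
  · have := mul_pos ht0 hK.1
    simp only [PiLp.smul_apply, smul_eq_mul]
    linarith
  · simp only [PiLp.smul_apply, smul_eq_mul, abs_mul]
    exact mul_le_mul_of_nonneg_left (hK.2 j) (abs_nonneg _)

/-- The cone over a null set of the boundary is a null set. -/
theorem volume_preimage_eq_zero_of_surface_null (hf : IsRadialBoundaryField Ω f)
    (hΩ : IsC1Domain Ω) (hb : Bornology.IsBounded Ω) (hs : StarConvex ℝ 0 Ω)
    {N : Set (Euc (m + 1))} (hN : Measure.hausdorffMeasure (m : ℝ) (N ∩ frontier Ω) = 0) :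
    volume (Ω ∩ f ⁻¹' N) = 0 := by
  have hsub : Ω ∩ f ⁻¹' N ⊆ {0} ∪ ⋃ i : Fin (m + 1),
      ((Ω \ {0}) ∩ f ⁻¹' N ∩ faceCone i 1 ∪ (Ω \ {0}) ∩ f ⁻¹' N ∩ faceCone i (-1)) := by
    rintro x ⟨hx, hxN⟩
    by_cases h0 : x = 0
    · exact Or.inl h0
    · obtain ⟨i, hi⟩ := exists_mem_faceCone h0
      refine Or.inr (Set.mem_iUnion.2 ⟨i, ?_⟩)
      exact hi.imp (fun h => ⟨⟨⟨hx, h0⟩, hxN⟩, h⟩) (fun h => ⟨⟨⟨hx, h0⟩, hxN⟩, h⟩)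
  refine measure_mono_null hsub (measure_union_null (measure_singleton 0)
    (measure_iUnion_null fun i => measure_union_null ?_ ?_))
  · exact surface_null_faceCone hf hΩ hb hs i 1 hN
  · exact surface_null_faceCone hf hΩ hb hs i (-1) hN

/-- On one face, `∂Ω` is the image of the cube `[-1, 1]ᵐ` under a Lipschitz map, obtained by composing
`f` with a scaled inclusion of the face. The truncated cone over a subset of the cube has Lebesgue
measure proportional to that of the subset. -/
theorem surface_faceCone_le (hf : IsRadialBoundaryField Ω f) (hΩ : IsC1Domain Ω)
    (hb : Bornology.IsBounded Ω) (hs : StarConvex ℝ 0 Ω) (i : Fin (m + 1)) {κ : ℝ}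
    (hκ : |κ| = 1) : ∃ C : ℝ≥0∞, C ≠ ⊤ ∧ ∀ A : Set (Euc (m + 1)), MeasurableSet A →
      Measure.hausdorffMeasure (m : ℝ) (A ∩ frontier Ω ∩ faceCone i κ) ≤
        C * volume (Ω ∩ f ⁻¹' A) := by
  have hκ0 : κ ≠ 0 := fun h => by simp [h] at hκ
  have hκ2 : κ * κ = 1 := by rw [← abs_mul_abs_self, hκ, mul_one]
  obtain ⟨ρ, hρ, hball⟩ := Metric.isOpen_iff.1 hΩ.isOpen 0 (hΩ.zero_mem hs)
  set Q : Set (Fin m → ℝ) := Set.Icc (-1) 1 with hQ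
  have hQc : IsCompact Q := isCompact_Icc
  obtain ⟨b, hb0, hbQ⟩ : ∃ b : ℝ, 0 < b ∧ ∀ y ∈ Q, ‖faceCoordInv i y‖ < b := by
    obtain ⟨b, hb⟩ := (hQc.image (contDiff_faceCoordInv i).continuous).isBounded.exists_norm_le
    exact ⟨|b| + 1, by positivity, fun y hy => by
      have := hb _ (Set.mem_image_of_mem _ hy); linarith [le_abs_self b]⟩
  set δ := ρ / b with hδ
  have hδ0 : 0 < δ := by positivity
  have hmem : ∀ y ∈ Q, ∀ s : ℝ, |s| ≤ δ → s • faceCoordInv i y ∈ Ω := by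
    intro y hy s hsδ
    refine hball ?_
    rw [mem_ball_zero_iff, norm_smul, Real.norm_eq_abs]
    calc |s| * ‖faceCoordInv i y‖ ≤ δ * ‖faceCoordInv i y‖ := by gcongr
      _ < δ * b := by gcongr; exact hbQ y hy
      _ = ρ := by rw [hδ]; field_simp
  have hκδ : |κ * δ| = δ := by rw [abs_mul, hκ, one_mul, abs_of_pos hδ0]
  have hκδ0 : κ * δ ≠ 0 := mul_ne_zero hκ0 hδ0.ne'
  set S : (Fin m → ℝ) → Euc (m + 1) := fun y => f ((κ * δ) • faceCoordInv i y) with hS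
  have hScd : ContDiffOn ℝ 1 S Q := by
    refine (hf.contDiffOn.mono (Set.sdiff_subset_sdiff_left subset_closure)).comp
      (((contDiff_faceCoordInv i).const_smul (κ * δ)).contDiffOn) fun y hy => ?_
    exact ⟨hmem y hy _ hκδ.le, smul_ne_zero hκδ0 (faceCoordInv_ne_zero i y)⟩
  obtain ⟨L, hL⟩ := hScd.exists_lipschitzOnWith one_ne_zero (convex_Icc _ _) hQc
  set I := Metric.ball (κ * (3 / 4 * δ)) (δ / 4) with hI
  have hIs : ∀ s ∈ I, δ / 2 ≤ |s| ∧ |s| ≤ δ ∧ 0 < κ * s := by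
    intro s hsI
    rw [hI, Metric.mem_ball, Real.dist_eq] at hsI
    have h1 : |κ * s - 3 / 4 * δ| < δ / 4 := by
      have : κ * s - 3 / 4 * δ = κ * (s - κ * (3 / 4 * δ)) := by
        rw [mul_sub, ← mul_assoc, hκ2, one_mul]
      rw [this, abs_mul, hκ, one_mul]; exact hsI
    have h2 : |s| = |κ * s| := by rw [abs_mul, hκ, one_mul]
    rw [abs_lt] at h1
    have h3 : 0 < κ * s := by linarith
    rw [h2, abs_of_pos h3]
    exact ⟨by linarith, by linarith, h3⟩
  set c := ∫⁻ s in I, ENNReal.ofReal (|s| ^ m) with hc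
  have hc0 : c ≠ 0 := by
    have : ENNReal.ofReal ((δ / 2) ^ m) * volume I ≤ c := by
      rw [← setLIntegral_const]
      refine setLIntegral_mono (by fun_prop) fun s hs => ENNReal.ofReal_le_ofReal ?_
      exact pow_le_pow_left₀ (by positivity) (hIs s hs).1 m
    refine (lt_of_lt_of_le ?_ this).ne'
    refine ENNReal.mul_pos ?_ (Metric.measure_ball_pos _ _ (by positivity)).ne'
    rw [Ne, ENNReal.ofReal_eq_zero, not_le]; positivity
  have hctop : c ≠ ⊤ := by
    have : c ≤ ENNReal.ofReal (δ ^ m) * volume I := by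
      rw [← setLIntegral_const]
      refine setLIntegral_mono (by fun_prop) fun s hs => ENNReal.ofReal_le_ofReal ?_
      exact pow_le_pow_left₀ (abs_nonneg _) (hIs s hs).2.1 m
    exact ne_top_of_le_ne_top (ENNReal.mul_ne_top ENNReal.ofReal_ne_top measure_ball_lt_top.ne) this
  refine ⟨(L : ℝ≥0∞) ^ (m : ℝ) * c⁻¹, ENNReal.mul_ne_top
    (ENNReal.rpow_ne_top_of_nonneg m.cast_nonneg ENNReal.coe_ne_top)
    (ENNReal.inv_ne_top.2 hc0), fun A hA => ?_⟩
  have hBm : MeasurableSet (Q ∩ S ⁻¹' A) := by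
    have h1 : Measurable (Q.domRestrict S) := hScd.continuousOn.domRestrict.measurable
    have h2 := hQc.measurableSet.subtype_image (h1 hA)
    convert h2 using 1
    ext y
    simp [and_comm]
  have hsub1 : A ∩ frontier Ω ∩ faceCone i κ ⊆ S '' (Q ∩ S ⁻¹' A) := by
    rintro x ⟨⟨hxA, hxf⟩, hK⟩
    have hy := faceCoord_mem_Icc hK
    have hx0 := faceCone_ne_zero hK
    have hpos : 0 < κ * δ / x i := by
      have : κ * δ / x i = δ * (κ * x i) / (x i) ^ 2 := by field_simp
      rw [this]
      have := hK.1
      positivity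
    have hx' : (κ * δ) • faceCoordInv i (faceCoord i x) = (κ * δ / x i) • x := by
      calc (κ * δ) • faceCoordInv i (faceCoord i x)
          = (κ * δ / x i) • (x i • faceCoordInv i (faceCoord i x)) := by
            rw [smul_smul, div_mul_cancel₀ _ hx0]
        _ = _ := by rw [smul_faceCoordInv_faceCoord hx0]
    have hSx : S (faceCoord i x) = x := by
      simp only [hS]
      rw [hx']
      refine hf.apply_smul_of_mem_frontier hΩ hb hs hxf hpos ?_
      rw [← hx']
      exact hmem _ hy _ hκδ.le
    exact ⟨faceCoord i x, ⟨hy, by rw [Set.mem_preimage, hSx]; exact hxA⟩, hSx⟩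
  have hsub2 : {x : Euc (m + 1) | x i ∈ I ∧ faceCoord i x ∈ Q ∩ S ⁻¹' A} ⊆ Ω ∩ f ⁻¹' A := by
    rintro x ⟨hxI, hxQ, hxA⟩
    obtain ⟨h1, h2, h3⟩ := hIs _ hxI
    have hx0 : x i ≠ 0 := fun h => by rw [h, mul_zero] at h3; exact lt_irrefl _ h3
    have hxΩ : x ∈ Ω := by
      rw [← smul_faceCoordInv_faceCoord hx0]; exact hmem _ hxQ _ h2
    refine ⟨hxΩ, ?_⟩
    have hx' : x = (κ * x i / δ) • ((κ * δ) • faceCoordInv i (faceCoord i x)) := by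
      rw [smul_smul]
      have : κ * x i / δ * (κ * δ) = x i := by
        field_simp
        rw [pow_two, hκ2]
      rw [this, smul_faceCoordInv_faceCoord hx0]
    have hz : (κ * δ) • faceCoordInv i (faceCoord i x) ∈ Ω := hmem _ hxQ _ hκδ.le
    have hz0 : (κ * δ) • faceCoordInv i (faceCoord i x) ≠ 0 :=
      smul_ne_zero hκδ0 (faceCoordInv_ne_zero i _)
    obtain ⟨t, ht, -, hft, hray⟩ := hf.exists_exit hΩ hb hs hz hz0
    have hr := hray (κ * x i / δ) (by positivity)
    rw [← hx'] at hr
    rw [Set.mem_preimage, hr.2 (hr.1.1 hxΩ), ← hft]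
    exact hxA
  calc Measure.hausdorffMeasure (m : ℝ) (A ∩ frontier Ω ∩ faceCone i κ)
      ≤ Measure.hausdorffMeasure (m : ℝ) (S '' (Q ∩ S ⁻¹' A)) := measure_mono hsub1
    _ ≤ (L : ℝ≥0∞) ^ (m : ℝ) * Measure.hausdorffMeasure (m : ℝ) (Q ∩ S ⁻¹' A) :=
        (hL.mono Set.inter_subset_left).hausdorffMeasure_image_le (by positivity)
    _ = (L : ℝ≥0∞) ^ (m : ℝ) * c⁻¹ * (c * volume (Q ∩ S ⁻¹' A)) := by
        rw [hausdorffMeasure_fin_pi, mul_assoc, ← mul_assoc c⁻¹, ENNReal.inv_mul_cancel hc0 hctop,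
          one_mul]
    _ ≤ _ := by
        rw [← volume_faceCoord_preimage i measurableSet_ball hBm]
        gcongr

theorem IsRadialBoundaryField.aemeasurable (hf : IsRadialBoundaryField Ω f) (hΩ : IsC1Domain Ω) :
    AEMeasurable f (volume.restrict Ω) := by
  have h1 : AEMeasurable f (volume.restrict (Ω \ {0})) :=
    hf.continuousOn.aemeasurable (hΩ.isOpen.sdiff isClosed_singleton).measurableSet
  rwa [Measure.restrict_congr_set (sdiff_null_ae_eq_self (measure_singleton 0))] at h1

/-- The surface measure of `∂Ω` is dominated by the image of Lebesgue measure on `Ω` under the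
projection `f` to the boundary. -/
theorem exists_surfaceMeasure_le (hf : IsRadialBoundaryField Ω f) (hΩ : IsC1Domain Ω)
    (hb : Bornology.IsBounded Ω) (hs : StarConvex ℝ 0 Ω) : ∃ C : ℝ≥0∞, C ≠ ⊤ ∧
      surfaceMeasure Ω ≤ C • (volume.restrict Ω).map f := by
  choose C1 hC1 hC1' using fun i => surface_faceCone_le hf hΩ hb hs i (κ := 1) (by simp)
  choose C2 hC2 hC2' using fun i => surface_faceCone_le hf hΩ hb hs i (κ := -1) (by simp)
  refine ⟨∑ i, (C1 i + C2 i), ?_, ?_⟩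
  · exact ENNReal.sum_ne_top.2 fun i _ => ENNReal.add_ne_top.2 ⟨hC1 i, hC2 i⟩
  · refine Measure.le_iff.2 fun A hA => ?_
    have hd : ((m + 1 : ℕ) : ℝ) - 1 = m := by push_cast; ring
    rw [surfaceMeasure, hd, Measure.restrict_apply hA, Measure.smul_apply,
      Measure.map_apply_of_aemeasurable (hf.aemeasurable hΩ) hA, smul_eq_mul,
      Measure.restrict_apply' hΩ.isOpen.measurableSet, Set.inter_comm (f ⁻¹' A)]
    have hsub : A ∩ frontier Ω ⊆ ⋃ i : Fin (m + 1),
        (A ∩ frontier Ω ∩ faceCone i 1 ∪ A ∩ frontier Ω ∩ faceCone i (-1)) := by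
      intro x hx
      obtain ⟨i, hi⟩ := exists_mem_faceCone (hΩ.ne_zero_of_mem_frontier hs hx.2)
      exact Set.mem_iUnion.2 ⟨i, hi.imp (fun h => ⟨hx, h⟩) (fun h => ⟨hx, h⟩)⟩
    refine (measure_mono hsub).trans ((measure_iUnion_fintype_le _ _).trans ?_)
    rw [Finset.sum_mul]
    refine Finset.sum_le_sum fun i _ => (measure_union_le _ _).trans ?_
    rw [add_mul]
    exact add_le_add (hC1' i A hA) (hC2' i A hA)

end Surface

/-! ### Mollification after dilation -/

section Mollify

open scoped Convolution

variable {n : ℕ} {F : Type*} [NormedAddCommGroup F] [NormedSpace ℝ F]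

/-- Jensen's inequality for the average of `G` against a normalized bump function. -/
theorem enorm_convolution_normed_pow_le (φ : ContDiffBump (0 : Euc n)) {G : Euc n → F}
    (hG : StronglyMeasurable G) {p : ℕ} (hp : 1 ≤ p) (y : Euc n) :
    ‖(φ.normed volume ⋆[ContinuousLinearMap.lsmul ℝ ℝ] G) y‖ₑ ^ p ≤
      ∫⁻ t, ENNReal.ofReal (φ.normed volume t) * ‖G (y - t)‖ₑ ^ p := by
  set ρ := φ.normed (volume : Measure (Euc n)) with hρ
  have hρm : Measurable (fun t => ENNReal.ofReal (ρ t)) :=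
    φ.continuous_normed.measurable.ennreal_ofReal
  set ν := (volume : Measure (Euc n)).withDensity (fun t => ENNReal.ofReal (ρ t)) with hν
  have hνp : IsProbabilityMeasure ν := ⟨by
    rw [hν, withDensity_apply _ MeasurableSet.univ, Measure.restrict_univ,
      ← ofReal_integral_eq_lintegral_ofReal φ.integrable_normed
        (Eventually.of_forall fun t => φ.nonneg_normed t), φ.integral_normed, ENNReal.ofReal_one]⟩
  have hGm : StronglyMeasurable (fun t => G (y - t)) :=
    hG.comp_measurable (measurable_const.sub measurable_id)
  have hGe : Measurable (fun t => ‖G (y - t)‖ₑ) := hGm.enorm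
  have h1 : ‖(ρ ⋆[ContinuousLinearMap.lsmul ℝ ℝ] G) y‖ₑ ≤ ∫⁻ t, ‖G (y - t)‖ₑ ∂ν := by
    rw [convolution_lsmul]
    refine (enorm_integral_le_lintegral_enorm _).trans (le_of_eq ?_)
    rw [hν, lintegral_withDensity_eq_lintegral_mul _ hρm hGe]
    refine lintegral_congr fun t => ?_
    rw [enorm_smul, Real.enorm_of_nonneg (φ.nonneg_normed t)]
    rfl
  have hp0 : (p : ℝ) ≠ 0 := by positivity
  have h2 := eLpNorm'_le_eLpNorm'_of_exponent_le (p := 1) (q := p) one_pos (by exact_mod_cast hp) ν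
    hGm.aestronglyMeasurable
  simp only [eLpNorm'_eq_lintegral_enorm, ENNReal.rpow_one, div_one, ENNReal.rpow_natCast] at h2
  calc _ ≤ (∫⁻ t, ‖G (y - t)‖ₑ ∂ν) ^ p := pow_le_pow_left₀ zero_le h1 p
    _ ≤ ((∫⁻ t, ‖G (y - t)‖ₑ ^ p ∂ν) ^ (1 / (p : ℝ))) ^ p := pow_le_pow_left₀ zero_le h2 p
    _ = ∫⁻ t, ‖G (y - t)‖ₑ ^ p ∂ν := by
        rw [← ENNReal.rpow_natCast, ← ENNReal.rpow_mul, one_div, inv_mul_cancel₀ hp0,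
          ENNReal.rpow_one]
    _ = _ := by
        rw [hν, lintegral_withDensity_eq_lintegral_mul _ hρm (hGe.pow_const p)]
        rfl

theorem lintegral_convolution_normed_pow_le (φ : ContDiffBump (0 : Euc n)) {G : Euc n → F}
    (hG : StronglyMeasurable G) {p : ℕ} (hp : 1 ≤ p) :
    ∫⁻ y, ‖(φ.normed volume ⋆[ContinuousLinearMap.lsmul ℝ ℝ] G) y‖ₑ ^ p ≤ ∫⁻ y, ‖G y‖ₑ ^ p := by
  have hρm : Measurable (fun t => ENNReal.ofReal (φ.normed (volume : Measure (Euc n)) t)) :=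
    φ.continuous_normed.measurable.ennreal_ofReal
  refine (lintegral_mono fun y => enorm_convolution_normed_pow_le φ hG hp y).trans (le_of_eq ?_)
  rw [lintegral_lintegral_swap]
  · calc _ = ∫⁻ t, ENNReal.ofReal (φ.normed (volume : Measure (Euc n)) t) * ∫⁻ y, ‖G y‖ₑ ^ p := by
          refine lintegral_congr fun t => ?_
          rw [lintegral_const_mul' _ _ ENNReal.ofReal_ne_top,
            lintegral_sub_right_eq_self (fun y => ‖G y‖ₑ ^ p) t]
      _ = _ := by
          rw [lintegral_mul_const _ hρm, ← ofReal_integral_eq_lintegral_ofReal φ.integrable_normed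
            (Eventually.of_forall fun t => φ.nonneg_normed t), φ.integral_normed,
            ENNReal.ofReal_one, one_mul]
  · have h1 : StronglyMeasurable (fun z : Euc n × Euc n => G (z.1 - z.2)) :=
      hG.comp_measurable (measurable_fst.sub measurable_snd)
    exact ((hρm.comp measurable_snd).mul (h1.enorm.pow_const p)).aemeasurable

theorem continuous_convolution_normed (φ : ContDiffBump (0 : Euc n)) {G : Euc n → F}
    (hG : LocallyIntegrable G) :
    Continuous (φ.normed volume ⋆[ContinuousLinearMap.lsmul ℝ ℝ] G) :=
  φ.hasCompactSupport_normed.continuous_convolution_left _ φ.continuous_normed hG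

/-- The operators `G ↦ (ρ ⋆ G)(s • ·)` are bounded on `L^p`, uniformly in `s ∈ [1/2, ∞)`. -/
theorem eLpNorm_convolution_normed_smul_le (φ : ContDiffBump (0 : Euc n)) {p : ℕ} (hp : 1 ≤ p)
    {G : Euc n → F} (hG : MemLp G p volume) {s : ℝ} (hs : 1 / 2 ≤ s) :
    eLpNorm (fun x => (φ.normed volume ⋆[ContinuousLinearMap.lsmul ℝ ℝ] G) (s • x)) p volume ≤
      ENNReal.ofReal (2 ^ n) ^ (1 / (p : ℝ)) * eLpNorm G p volume := by
  obtain ⟨G', hG', hGG'⟩ := hG.1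
  have hs0 : 0 < s := by linarith
  have hconv : (φ.normed volume ⋆[ContinuousLinearMap.lsmul ℝ ℝ] G) =
      (φ.normed volume ⋆[ContinuousLinearMap.lsmul ℝ ℝ] G') :=
    convolution_congr _ (ae_eq_refl _) hGG'
  have hp' : (1 : ℝ≥0∞) ≤ p := by exact_mod_cast hp
  have hc := continuous_convolution_normed φ (hG.locallyIntegrable hp')
  rw [eLpNorm_congr_ae hGG']
  rw [hconv] at hc ⊢
  set H := (φ.normed volume ⋆[ContinuousLinearMap.lsmul ℝ ℝ] G') with hH
  have hp0 : (p : ℝ≥0∞) ≠ 0 := by positivity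
  rw [eLpNorm_eq_lintegral_rpow_enorm_toReal hp0 (ENNReal.natCast_ne_top p),
    eLpNorm_eq_lintegral_rpow_enorm_toReal hp0 (ENNReal.natCast_ne_top p), ENNReal.toReal_natCast,
    ← ENNReal.mul_rpow_of_nonneg _ _ (by positivity)]
  refine ENNReal.rpow_le_rpow ?_ (by positivity)
  simp only [ENNReal.rpow_natCast]
  have hHm : Measurable (fun y => ‖H y‖ₑ ^ p) := hc.enorm.measurable.pow_const p
  calc ∫⁻ x, ‖H (s • x)‖ₑ ^ p = ∫⁻ y, ‖H y‖ₑ ^ p ∂(Measure.map (fun x => s • x) volume) := by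
        rw [lintegral_map hHm (measurable_const_smul s)]
    _ = ENNReal.ofReal |(s ^ n)⁻¹| * ∫⁻ y, ‖H y‖ₑ ^ p := by
        rw [Measure.map_addHaar_smul _ hs0.ne', lintegral_smul_measure, finrank_euclideanSpace_fin,
          smul_eq_mul]
    _ ≤ _ := by
        refine mul_le_mul' (ENNReal.ofReal_le_ofReal ?_)
          (lintegral_convolution_normed_pow_le φ hG' hp)
        rw [abs_of_pos (by positivity), ← inv_pow]
        refine pow_le_pow_left₀ (by positivity) ?_ n
        rw [inv_le_comm₀ hs0 two_pos]
        linarith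

/-- Dilation factors `s k → 1` and mollifiers `φ k` shrinking so fast that the mollification at
`s k • x`, `x ∈ closure Ω`, only sees values inside `Ω`. -/
structure DilationMollifier (Ω : Set (Euc n)) where
  /-- The dilation factors. -/
  s : ℕ → ℝ
  /-- The mollifiers. -/
  φ : ℕ → ContDiffBump (0 : Euc n)
  half_le : ∀ k, 1 / 2 ≤ s k
  le_one : ∀ k, s k ≤ 1
  tendsto_s : Tendsto s atTop (𝓝 1)
  tendsto_rOut : Tendsto (fun k => (φ k).rOut) atTop (𝓝 0)
  closedBall_subset : ∀ k, ∀ x ∈ closure Ω, Metric.closedBall (s k • x) (φ k).rOut ⊆ Ω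

theorem exists_dilationMollifier {Ω : Set (Euc n)} (hO : IsOpen Ω) (hb : Bornology.IsBounded Ω)
    (hdil : ∀ x ∈ closure Ω, ∀ s : ℝ, 0 < s → s < 1 → s • x ∈ Ω) :
    Nonempty (DilationMollifier Ω) := by
  set s : ℕ → ℝ := fun k => 1 - 1 / ((k : ℝ) + 2) with hs
  have hs1 : ∀ k, s k < 1 := fun k => by
    simp only [hs]
    have : 0 < 1 / ((k : ℝ) + 2) := by positivity
    linarith
  have hs2 : ∀ k, 1 / 2 ≤ s k := fun k => by
    simp only [hs]
    have : 1 / ((k : ℝ) + 2) ≤ 1 / 2 := by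
      apply one_div_le_one_div_of_le two_pos; linarith [(k.cast_nonneg : (0 : ℝ) ≤ k)]
    linarith
  have hex : ∀ k : ℕ, ∃ δ > 0, δ ≤ 1 / ((k : ℝ) + 1) ∧
      ∀ x ∈ closure Ω, Metric.closedBall (s k • x) δ ⊆ Ω := by
    intro k
    have hcomp : IsCompact ((fun x => s k • x) '' closure Ω) :=
      hb.isCompact_closure.image (continuous_const_smul _)
    obtain ⟨δ, hδ, hsub⟩ := hcomp.exists_cthickening_subset_open hO (by
      rintro _ ⟨x, hx, rfl⟩
      exact hdil x hx _ (by linarith [hs2 k]) (hs1 k))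
    refine ⟨min δ (1 / ((k : ℝ) + 1)), lt_min hδ (by positivity), min_le_right _ _, ?_⟩
    intro x hx
    refine (Metric.closedBall_subset_closedBall (min_le_left _ _)).trans (le_trans ?_ hsub)
    exact Metric.closedBall_subset_cthickening (Set.mem_image_of_mem (fun x => s k • x) hx) δ
  choose δ hδ0 hδ1 hδ2 using hex
  refine ⟨⟨s, fun k => ⟨δ k / 2, δ k, half_pos (hδ0 k), half_lt_self (hδ0 k)⟩, hs2,
    fun k => (hs1 k).le, ?_, ?_, hδ2⟩⟩
  · have h1 : Tendsto (fun k : ℕ => 1 / ((k : ℝ) + 2)) atTop (𝓝 0) := by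
      have := (tendsto_add_atTop_iff_nat 1).2 (tendsto_one_div_add_atTop_nhds_zero_nat (𝕜 := ℝ))
      refine this.congr fun k => ?_
      push_cast; ring
    simpa [hs] using h1.const_sub 1
  · exact squeeze_zero (fun k => (hδ0 k).le) hδ1 tendsto_one_div_add_atTop_nhds_zero_nat

namespace DilationMollifier

variable {Ω : Set (Euc n)} (D : DilationMollifier Ω)

/-- The approximation `x ↦ (ρ_k ⋆ G)(s_k x)` of `G`. -/
noncomputable def approx (k : ℕ) (G : Euc n → F) (x : Euc n) : F :=
  ((D.φ k).normed volume ⋆[ContinuousLinearMap.lsmul ℝ ℝ] G) (D.s k • x)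

theorem continuous_approx {G : Euc n → F} (hG : LocallyIntegrable G) (k : ℕ) :
    Continuous (D.approx k G) :=
  (continuous_convolution_normed _ hG).comp (continuous_const_smul _)

/-- Uniform approximation, when `G` agrees on `Ω` with a function continuous on `closure Ω`. -/
theorem eventually_norm_approx_sub_le [CompleteSpace F] (hb : Bornology.IsBounded Ω)
    {G g : Euc n → F} (hGm : AEStronglyMeasurable G volume) (hGg : ∀ x ∈ Ω, G x = g x)
    (hg : ContinuousOn g (closure Ω)) {ε : ℝ} (hε : 0 < ε) :
    ∀ᶠ k in atTop, ∀ x ∈ closure Ω, ‖D.approx k G x - g x‖ ≤ ε := by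
  have hcomp : IsCompact (closure Ω) := hb.isCompact_closure
  obtain ⟨δ, hδ, huc⟩ := Metric.uniformContinuousOn_iff.1
    (hcomp.uniformContinuousOn_of_continuous hg) (ε / 2) (half_pos hε)
  obtain ⟨B, hB⟩ := hcomp.isBounded.exists_norm_le
  have h1 : ∀ᶠ k in atTop, (1 - D.s k) * |B| < δ := by
    have : Tendsto (fun k => (1 - D.s k) * |B|) atTop (𝓝 ((1 - 1) * |B|)) :=
      (D.tendsto_s.const_sub 1).mul_const _
    rw [sub_self, zero_mul] at this
    exact this.eventually (eventually_lt_nhds hδ)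
  have h2 : ∀ᶠ k in atTop, (D.φ k).rOut < δ := D.tendsto_rOut.eventually (eventually_lt_nhds hδ)
  filter_upwards [h1, h2] with k hk1 hk2 x hx
  have hsub := D.closedBall_subset k x hx
  have hsx : D.s k • x ∈ Ω := hsub (Metric.mem_closedBall_self (D.φ k).rOut_pos.le)
  have h3 : dist (D.approx k G x) (G (D.s k • x)) ≤ ε / 2 := by
    refine ContDiffBump.dist_normed_convolution_le hGm fun y hy => ?_
    have hyΩ : y ∈ Ω := hsub (Metric.ball_subset_closedBall hy)
    rw [hGg y hyΩ, hGg _ hsx]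
    exact (huc y (subset_closure hyΩ) _ (subset_closure hsx)
      ((Metric.mem_ball.1 hy).trans hk2)).le
  have h4 : dist (G (D.s k • x)) (g x) ≤ ε / 2 := by
    rw [hGg _ hsx]
    refine (huc _ (subset_closure hsx) x hx ?_).le
    have h5 : D.s k • x - x = -((1 - D.s k) • x) := by rw [sub_smul, one_smul, neg_sub]
    rw [dist_eq_norm, h5, norm_neg, norm_smul, Real.norm_eq_abs,
      abs_of_nonneg (by linarith [D.le_one k])]
    refine lt_of_le_of_lt (mul_le_mul_of_nonneg_left ?_ (by linarith [D.le_one k])) hk1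
    exact (hB x hx).trans (le_abs_self B)
  rw [← dist_eq_norm]
  linarith [dist_triangle (D.approx k G x) (G (D.s k • x)) (g x)]

/-- Approximation in `L^p(Ω)`: by the uniform bound it suffices to approximate continuous
functions, and these are approximated uniformly. -/
theorem tendsto_eLpNorm_approx_sub [CompleteSpace F] (hO : IsOpen Ω) (hb : Bornology.IsBounded Ω)
    {p : ℕ} (hp : 1 ≤ p) {G : Euc n → F} (hG : MemLp G p volume) :
    Tendsto (fun k => eLpNorm (fun x => D.approx k G x - G x) p (volume.restrict Ω)) atTop
      (𝓝 0) := by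
  have hp' : (1 : ℝ≥0∞) ≤ p := by exact_mod_cast hp
  set C : ℝ≥0∞ := ENNReal.ofReal (2 ^ n) ^ (1 / (p : ℝ)) with hC
  have hCtop : C ≠ ⊤ := ENNReal.rpow_ne_top_of_nonneg (by positivity) ENNReal.ofReal_ne_top
  set V : ℝ≥0∞ := (volume.restrict Ω) Set.univ ^ (p : ℝ≥0∞).toReal⁻¹ with hV
  have hVtop : V ≠ ⊤ := by
    refine ENNReal.rpow_ne_top_of_nonneg (by positivity) ?_
    rw [Measure.restrict_apply_univ]
    exact hb.measure_lt_top.ne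
  rw [ENNReal.tendsto_nhds_zero]
  intro ε hε
  by_cases hεtop : ε = ⊤
  · rw [hεtop]; exact Eventually.of_forall fun _ => le_top
  set ε' := ε / (C + V + 1) with hε'
  have hden : C + V + 1 ≠ ⊤ := by simp [hCtop, hVtop]
  have hε'0 : ε' ≠ 0 := (ENNReal.div_pos hε.ne' hden).ne'
  have hε'top : ε' ≠ ⊤ := ENNReal.div_ne_top hεtop (by simp)
  obtain ⟨g, hgs, hgε, hgc, hgp⟩ := hG.exists_hasCompactSupport_eLpNorm_sub_le
    (ENNReal.natCast_ne_top p) hε'0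
  have hev := D.eventually_norm_approx_sub_le hb (G := g) (g := g) hgc.aestronglyMeasurable
    (fun _ _ => rfl) hgc.continuousOn (ENNReal.toReal_pos hε'0 hε'top)
  filter_upwards [hev] with k hk
  have hli := hG.locallyIntegrable hp'
  have hlig := hgp.locallyIntegrable hp'
  have hd : MemLp (G - g) p volume := hG.sub hgp
  have hlid := hd.locallyIntegrable hp'
  have hsplit : ∀ x, D.approx k G x - G x =
      (D.approx k (G - g) x + (D.approx k g x - g x)) - (G - g) x := by
    intro x
    have hcs := (D.φ k).hasCompactSupport_normed (μ := volume)
    have hcc := (D.φ k).continuous_normed (μ := volume)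
    have h1 : D.approx k ((G - g) + g) x = D.approx k (G - g) x + D.approx k g x :=
      ConvolutionExistsAt.distrib_add (hcs.convolutionExists_left _ hcc hlid _)
        (hcs.convolutionExists_left _ hcc hlig _)
    rw [sub_add_cancel] at h1
    rw [h1, Pi.sub_apply]; abel
  have e1 : eLpNorm (D.approx k (G - g)) p (volume.restrict Ω) ≤ C * ε' :=
    (eLpNorm_restrict_le _ _ _ _).trans
      ((eLpNorm_convolution_normed_smul_le (D.φ k) hp hd (D.half_le k)).trans
        (mul_le_mul_right hgε C))
  have e2 : eLpNorm (fun x => D.approx k g x - g x) p (volume.restrict Ω) ≤ V * ε' := by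
    refine (eLpNorm_le_of_ae_bound (C := ε'.toReal) ?_).trans
      (by rw [ENNReal.ofReal_toReal hε'top])
    filter_upwards [ae_restrict_mem hO.measurableSet] with x hx using hk x (subset_closure hx)
  have e3 : eLpNorm (G - g) p (volume.restrict Ω) ≤ ε' :=
    (eLpNorm_restrict_le _ _ _ _).trans hgε
  have m1 : AEStronglyMeasurable (D.approx k (G - g)) (volume.restrict Ω) :=
    (D.continuous_approx hlid k).aestronglyMeasurable
  have m2 : AEStronglyMeasurable (fun x => D.approx k g x - g x) (volume.restrict Ω) :=
    ((D.continuous_approx hlig k).sub hgc).aestronglyMeasurable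
  have m3 : AEStronglyMeasurable (G - g) (volume.restrict Ω) := hd.1.restrict
  calc eLpNorm (fun x => D.approx k G x - G x) p (volume.restrict Ω)
      = eLpNorm ((D.approx k (G - g) + (fun x => D.approx k g x - g x)) - (G - g)) p
          (volume.restrict Ω) := by
        congr 1; ext x; exact hsplit x
    _ ≤ (C * ε' + V * ε') + ε' :=
        (eLpNorm_sub_le (m1.add m2) m3 hp').trans
          (add_le_add ((eLpNorm_add_le m1 m2 hp').trans (add_le_add e1 e2)) e3)
    _ = ε' * (C + V + 1) := by ring
    _ = ε := ENNReal.div_mul_cancel (by simp) hden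

end DilationMollifier

end Mollify

/-! ### Density of smooth functions in the Sobolev space -/

section Density

open scoped Convolution

variable {n : ℕ} {Ω : Set (Euc n)}

/-- A `C¹` function with gradient `Dv` on `Ω` is in `W^{1,p}(Ω)`. -/
theorem memW1_of_contDiff (hO : IsOpen Ω) (hb : Bornology.IsBounded Ω) (p : ℝ≥0∞)
    {v : Euc n → ℝ} {Dv : Euc n → Euc n} (hv : ContDiff ℝ 1 v) (hDv : Continuous Dv)
    (hgrad : ∀ x ∈ Ω, ∀ e, fderiv ℝ v x e = inner ℝ (Dv x) e) : MemW1 Ω p v Dv := by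
  have hmem : ∀ {F : Type} [NormedAddCommGroup F] {w : Euc n → F}
      [SecondCountableTopologyEither (Euc n) F], Continuous w → MemLp w p (volume.restrict Ω) := by
    intro F _ w _ hw
    have hfin : IsFiniteMeasure (volume.restrict Ω) :=
      ⟨by rw [Measure.restrict_apply_univ]; exact hb.measure_lt_top⟩
    obtain ⟨C, hC⟩ := (hb.isCompact_closure.image hw).isBounded.exists_norm_le
    refine MemLp.of_bound hw.aestronglyMeasurable C ?_
    filter_upwards [ae_restrict_mem hO.measurableSet] with x hx
    exact hC _ (Set.mem_image_of_mem _ (subset_closure hx))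
  refine ⟨⟨hv.continuous.locallyIntegrable.locallyIntegrableOn _,
    hDv.locallyIntegrable.locallyIntegrableOn _, fun φ hφ hφc hφs e => ?_⟩, hmem hv.continuous,
    hmem hDv⟩
  have hφ1 : ContDiff ℝ 1 φ := hφ.of_le (by exact_mod_cast le_top)
  have hdφ : Continuous (fun x => fderiv ℝ φ x e) :=
    (hφ1.continuous_fderiv one_ne_zero).clm_apply continuous_const
  have hdv : Continuous (fun x => fderiv ℝ v x e) :=
    (hv.continuous_fderiv one_ne_zero).clm_apply continuous_const
  have hφ0 : ∀ x, x ∉ Ω → φ x = 0 := fun x hx =>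
    image_eq_zero_of_notMem_tsupport fun h => hx (hφs h)
  have hdφc : HasCompactSupport (fun x => fderiv ℝ φ x e) := hφc.fderiv_apply ℝ e
  have hdφ0 : ∀ x, x ∉ Ω → fderiv ℝ φ x e = 0 := fun x hx => by
    have : fderiv ℝ φ x = 0 := by
      by_contra h
      exact hx (hφs (support_fderiv_subset ℝ h))
    rw [this]; rfl
  have hibp := integral_mul_fderiv_eq_neg_fderiv_mul_of_integrable (μ := volume) (f := v) (g := φ)
    (v := e) ((hdv.mul hφ.continuous).integrable_of_hasCompactSupport hφc.mul_left)
    ((hv.continuous.mul hdφ).integrable_of_hasCompactSupport hdφc.mul_left)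
    ((hv.continuous.mul hφ.continuous).integrable_of_hasCompactSupport hφc.mul_left)
    (fun x _ => hv.differentiable one_ne_zero x) (fun x _ => hφ1.differentiable one_ne_zero x)
  rw [setIntegral_eq_integral_of_forall_compl_eq_zero (fun x hx => by rw [hdφ0 x hx, mul_zero]),
    hibp, setIntegral_congr_fun (g := fun x => φ x * fderiv ℝ v x e) hO.measurableSet
      (fun x hx => by simp only [hgrad x hx e]),
    setIntegral_eq_integral_of_forall_compl_eq_zero (fun x hx => by rw [hφ0 x hx, zero_mul])]
  simp only [mul_comm]

namespace DilationMollifier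

variable (D : DilationMollifier Ω)

theorem contDiff_approx {G : Euc n → ℝ} (hG : LocallyIntegrable G) (k : ℕ) :
    ContDiff ℝ 1 (D.approx k G) := by
  have h1 : ContDiff ℝ ((1 : ℕ∞) : WithTop ℕ∞)
      ((D.φ k).normed volume ⋆[ContinuousLinearMap.lsmul ℝ ℝ] G) :=
    (D.φ k).hasCompactSupport_normed.contDiff_convolution_left _ (D.φ k).contDiff_normed hG
  exact h1.comp (contDiff_const_smul (D.s k))

/-- The weak gradient of `u` may be tested against `y ↦ ρ_k (s_k x - y)`, which is supported
in `Ω`; hence on `Ω` mollification commutes with the gradient, up to the dilation factor. -/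
theorem fderiv_approx_indicator {u : Euc n → ℝ} {Du : Euc n → Euc n} (hO : IsOpen Ω)
    (hu : HasWeakGradient Ω u Du) (hU : LocallyIntegrable (Ω.indicator u))
    (hDU : LocallyIntegrable (Ω.indicator Du)) (k : ℕ) {x : Euc n} (hx : x ∈ Ω) (e : Euc n) :
    fderiv ℝ (D.approx k (Ω.indicator u)) x e =
      inner ℝ (D.s k • D.approx k (Ω.indicator Du) x) e := by
  set ρ := (D.φ k).normed (volume : Measure (Euc n)) with hρ
  set s := D.s k with hs
  have hρc : HasCompactSupport ρ := (D.φ k).hasCompactSupport_normed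
  have hρd : ContDiff ℝ ∞ ρ := (D.φ k).contDiff_normed (n := ⊤)
  have hρ1 : ContDiff ℝ 1 ρ := hρd.of_le (by exact_mod_cast le_top)
  have hρf : Continuous (fderiv ℝ ρ) := hρ1.continuous_fderiv one_ne_zero
  have hder := hρc.hasFDerivAt_convolution_left (μ := volume) (ContinuousLinearMap.lsmul ℝ ℝ) hρ1 hU
    (s • x)
  have hder2 : HasFDerivAt (D.approx k (Ω.indicator u)) _ x :=
    hder.comp x ((hasFDerivAt_id x).const_smul s)
  rw [hder2.fderiv]
  simp only [ContinuousLinearMap.comp_apply, smul_apply,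
    ContinuousLinearMap.id_apply, map_smul, smul_eq_mul, inner_smul_left, RCLike.conj_to_real]
  congr 1
  -- the derivative falls on `ρ`
  have hint := hρc.fderiv (𝕜 := ℝ) |>.convolutionExists_left (μ := volume)
    (ContinuousLinearMap.precompL (Euc n) (ContinuousLinearMap.lsmul ℝ ℝ)) hρf hU (s • x)
  have h1 : ((fderiv ℝ ρ ⋆[ContinuousLinearMap.precompL (Euc n) (ContinuousLinearMap.lsmul ℝ ℝ)]
      Ω.indicator u) (s • x)) e = ∫ y in Ω, u y * fderiv ℝ ρ (s • x - y) e := by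
    rw [convolution_def, ContinuousLinearMap.integral_apply hint e,
      ← integral_indicator hO.measurableSet, ← integral_sub_left_eq_self _ volume (s • x)]
    refine integral_congr_ae (Eventually.of_forall fun y => ?_)
    by_cases hy : y ∈ Ω
    · simp [hy, mul_comm]
    · simp [hy]
  rw [h1]
  -- the test function
  set φ : Euc n → ℝ := fun y => ρ (s • x - y) with hφ
  have hφd : ContDiff ℝ ∞ φ := hρd.comp (contDiff_const.sub contDiff_id)
  have hsupp : tsupport φ ⊆ Metric.closedBall (s • x) (D.φ k).rOut := by
    refine closure_minimal (fun y hy => ?_) Metric.isClosed_closedBall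
    have h2 : s • x - y ∈ Function.support ρ := hy
    rw [hρ, (D.φ k).support_normed_eq, mem_ball_zero_iff] at h2
    rw [Metric.mem_closedBall, dist_comm, dist_eq_norm]
    exact h2.le
  have hφc : HasCompactSupport φ :=
    (isCompact_closedBall _ _).of_isClosed_subset (isClosed_tsupport _) hsupp
  have htest := hu.integral_eq φ hφd hφc
    (hsupp.trans (D.closedBall_subset k x (subset_closure hx))) e
  have hfd : ∀ y, fderiv ℝ φ y e = - fderiv ℝ ρ (s • x - y) e := by
    intro y
    have h3 : HasFDerivAt φ _ y := HasFDerivAt.comp y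
      (hρ1.differentiable one_ne_zero (s • x - y)).hasFDerivAt ((hasFDerivAt_id y).const_sub (s • x))
    rw [h3.fderiv]
    simp
  simp only [hfd, mul_neg, integral_neg, neg_inj] at htest
  rw [htest]
  have hint2 : Integrable (fun t => ρ t • Ω.indicator Du (s • x - t)) :=
    hρc.convolutionExists_left (μ := volume) (ContinuousLinearMap.lsmul ℝ ℝ)
    hρ1.continuous hDU (s • x)
  have happ : D.approx k (Ω.indicator Du) x =
      ∫ t, ρ t • Ω.indicator Du (s • x - t) := convolution_lsmul
  rw [happ, real_inner_comm, ← integral_inner hint2, ← integral_indicator hO.measurableSet,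
    ← integral_sub_left_eq_self _ volume (s • x)]
  refine integral_congr_ae (Eventually.of_forall fun t => ?_)
  by_cases ht : s • x - t ∈ Ω
  · simp [ht, hφ, inner_smul_right, real_inner_comm]
  · simp [ht]

end DilationMollifier

/-- `C¹` functions are dense in `W^{1,p}(Ω)`, and a function continuous on `closure Ω` is
simultaneously approximated uniformly. -/
theorem exists_contDiff_approx (hO : IsOpen Ω) (hb : Bornology.IsBounded Ω)
    (hdil : ∀ x ∈ closure Ω, ∀ s : ℝ, 0 < s → s < 1 → s • x ∈ Ω) {p : ℕ} (hp : 1 ≤ p)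
    {u : Euc n → ℝ} {Du : Euc n → Euc n} (hu : MemW1 Ω p u Du) {ε : ℝ} (hε : 0 < ε) :
    ∃ (v : Euc n → ℝ) (Dv : Euc n → Euc n), ContDiff ℝ 1 v ∧ Continuous Dv ∧
      (∀ x ∈ Ω, ∀ e, fderiv ℝ v x e = inner ℝ (Dv x) e) ∧
      eLpNorm (fun x => v x - u x) p (volume.restrict Ω) ≤ ENNReal.ofReal ε ∧
      eLpNorm (fun x => Dv x - Du x) p (volume.restrict Ω) ≤ ENNReal.ofReal ε ∧
      (ContinuousOn u (closure Ω) → ∀ x ∈ closure Ω, ‖v x - u x‖ ≤ ε) := by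
  obtain ⟨D⟩ := exists_dilationMollifier hO hb hdil
  have hp' : (1 : ℝ≥0∞) ≤ p := by exact_mod_cast hp
  have hU : MemLp (Ω.indicator u) p volume :=
    (memLp_indicator_iff_restrict hO.measurableSet).2 hu.memLp
  have hDU : MemLp (Ω.indicator Du) p volume :=
    (memLp_indicator_iff_restrict hO.measurableSet).2 hu.memLp_grad
  have hUl := hU.locallyIntegrable hp'
  have hDUl := hDU.locallyIntegrable hp'
  have hε2 : 0 < ENNReal.ofReal (ε / 2) := by simpa using hε
  have hε1 : 0 < ENNReal.ofReal ε := by simpa using hε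
  have t1 := ENNReal.tendsto_nhds_zero.1 (D.tendsto_eLpNorm_approx_sub hO hb hp hU) _ hε1
  have t2 := ENNReal.tendsto_nhds_zero.1 (D.tendsto_eLpNorm_approx_sub hO hb hp hDU) _ hε2
  have t3 : ∀ᶠ k in atTop, ContinuousOn u (closure Ω) →
      ∀ x ∈ closure Ω, ‖D.approx k (Ω.indicator u) x - u x‖ ≤ ε := by
    by_cases hc : ContinuousOn u (closure Ω)
    · filter_upwards [D.eventually_norm_approx_sub_le hb (G := Ω.indicator u) (g := u) hU.1
        (fun x hx => Set.indicator_of_mem hx _) hc hε] with k hk _ using hk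
    · exact Eventually.of_forall fun k h => absurd h hc
  have t4 : ∀ᶠ k in atTop, ENNReal.ofReal (1 - D.s k) * eLpNorm Du p (volume.restrict Ω) ≤
      ENNReal.ofReal (ε / 2) := by
    have h1 : Tendsto (fun k => ENNReal.ofReal (1 - D.s k)) atTop (𝓝 0) := by
      have := ENNReal.tendsto_ofReal (D.tendsto_s.const_sub 1)
      rwa [sub_self, ENNReal.ofReal_zero] at this
    have h2 := ENNReal.Tendsto.mul_const h1 (Or.inr hu.memLp_grad.eLpNorm_ne_top)
    rw [zero_mul] at h2
    exact ENNReal.tendsto_nhds_zero.1 h2 _ hε2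
  obtain ⟨k, h1, h2, h3, h4⟩ := (t1.and (t2.and (t3.and t4))).exists
  refine ⟨D.approx k (Ω.indicator u), fun x => D.s k • D.approx k (Ω.indicator Du) x,
    D.contDiff_approx hUl k, (continuous_const_smul (D.s k)).comp (D.continuous_approx hDUl k),
    fun x hx e => D.fderiv_approx_indicator hO hu.weakGradient hUl hDUl k hx e, ?_, ?_, h3⟩
  · refine le_trans (le_of_eq (eLpNorm_congr_ae ?_)) h1
    filter_upwards [ae_restrict_mem hO.measurableSet] with x hx
    rw [Set.indicator_of_mem hx]
  · have hs0 : 0 ≤ D.s k := by linarith [D.half_le k]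
    have hs1 := D.le_one k
    set w := fun x => D.approx k (Ω.indicator Du) x - Ω.indicator Du x with hw
    have hwm : AEStronglyMeasurable w (volume.restrict Ω) :=
      (D.continuous_approx hDUl k).aestronglyMeasurable.sub hDU.1.restrict
    calc eLpNorm (fun x => D.s k • D.approx k (Ω.indicator Du) x - Du x) p (volume.restrict Ω)
        = eLpNorm ((D.s k • w) - ((1 - D.s k) • Du)) p (volume.restrict Ω) := by
          refine eLpNorm_congr_ae ?_
          filter_upwards [ae_restrict_mem hO.measurableSet] with x hx
          simp only [hw, Pi.sub_apply, Pi.smul_apply, Set.indicator_of_mem hx, sub_smul, one_smul,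
            smul_sub]
          abel
      _ ≤ eLpNorm (D.s k • w) p (volume.restrict Ω) +
            eLpNorm ((1 - D.s k) • Du) p (volume.restrict Ω) :=
          eLpNorm_sub_le (hwm.const_smul _) (hu.memLp_grad.1.const_smul _) hp'
      _ ≤ ENNReal.ofReal (ε / 2) + ENNReal.ofReal (ε / 2) := by
          refine add_le_add ?_ ?_
          · rw [eLpNorm_const_smul, Real.enorm_eq_ofReal hs0]
            calc _ ≤ 1 * eLpNorm w p (volume.restrict Ω) := by
                  gcongr
                  exact ENNReal.ofReal_le_one.2 hs1
              _ ≤ _ := by rw [one_mul]; exact h2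
          · rw [eLpNorm_const_smul, Real.enorm_eq_ofReal (by linarith)]
            exact h4
      _ = ENNReal.ofReal ε := by
          rw [← ENNReal.ofReal_add (by positivity) (by positivity), add_halves]

end Density

/-! ### Trace estimate and passage to the limit -/

section Trace

/-- The radial component of a vector field. -/
noncomputable def radialPart {n : ℕ} (W : Euc n → Euc n) (x : Euc n) : ℝ :=
  inner ℝ (‖x‖⁻¹ • x) (W x)

/-- The difference `u - g ∘ f` divided by the Hardy weight `|x| log (M / |x|)`. -/
noncomputable def hardyQuotient {n : ℕ} (f : Euc n → Euc n) (M : ℝ) (u g : Euc n → ℝ)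
    (x : Euc n) : ℝ :=
  (u x - g (f x)) / (‖x‖ * Real.log (M / ‖x‖))

theorem abs_radialPart_le {n : ℕ} (W : Euc n → Euc n) (x : Euc n) : ‖radialPart W x‖ ≤ ‖W x‖ := by
  refine (norm_inner_le_norm _ _).trans ?_
  have : ‖‖x‖⁻¹ • x‖ ≤ 1 := by
    rw [norm_smul, norm_inv, norm_norm]; exact inv_mul_le_one
  simpa using mul_le_mul_of_nonneg_right this (norm_nonneg (W x))

theorem aestronglyMeasurable_radialPart {n : ℕ} {μ : Measure (Euc n)} {W : Euc n → Euc n}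
    (hW : AEStronglyMeasurable W μ) : AEStronglyMeasurable (radialPart W) μ := by
  have h : Measurable (fun x : Euc n => ‖x‖⁻¹ • x) := measurable_norm.inv.smul measurable_id
  exact h.aestronglyMeasurable.inner hW

variable {k : ℕ} {Ω : Set (Euc (k + 2))} {f : Euc (k + 2) → Euc (k + 2)}

theorem hardy_eLpNorm (hf : IsRadialBoundaryField Ω f) (hΩ : IsC1Domain Ω)
    (hb : Bornology.IsBounded Ω) (hs : StarConvex ℝ 0 Ω) {M : ℝ} (hM : ∀ x ∈ closure Ω, ‖x‖ < M)
    {v : Euc (k + 2) → ℝ} {Dv : Euc (k + 2) → Euc (k + 2)} (hv : ContDiff ℝ 1 v)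
    (hgrad : ∀ x ∈ Ω, ∀ e, fderiv ℝ v x e = inner ℝ (Dv x) e) :
    eLpNorm (hardyQuotient f M v v) ((k + 2 : ℕ) : ℝ≥0∞) (volume.restrict Ω) ≤
      ENNReal.ofReal ((k + 2) / (k + 1)) *
        eLpNorm (radialPart Dv) ((k + 2 : ℕ) : ℝ≥0∞) (volume.restrict Ω) := by
  have h := hardy_lintegral_domain hf hΩ hb hs hM hv
  have hp0 : ((k + 2 : ℕ) : ℝ≥0∞) ≠ 0 := by simp
  rw [← Real.enorm_eq_ofReal (by positivity), ← eLpNorm_const_smul,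
    eLpNorm_eq_lintegral_rpow_enorm_toReal hp0 (ENNReal.natCast_ne_top _),
    eLpNorm_eq_lintegral_rpow_enorm_toReal hp0 (ENNReal.natCast_ne_top _), ENNReal.toReal_natCast]
  refine ENNReal.rpow_le_rpow ?_ (by positivity)
  simp only [ENNReal.rpow_natCast]
  refine h.trans (le_of_eq (setLIntegral_congr_fun hΩ.isOpen.measurableSet fun x hx => ?_))
  simp only [hgrad x hx, radialPart, Pi.smul_apply, smul_eq_mul, real_inner_comm]

theorem aestronglyMeasurable_comp_field (hf : IsRadialBoundaryField Ω f) (hΩ : IsC1Domain Ω)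
    {v : Euc (k + 2) → ℝ} (hv : Continuous v) :
    AEStronglyMeasurable (fun x => v (f x)) (volume.restrict Ω) :=
  (hv.measurable.comp_aemeasurable (hf.aemeasurable hΩ)).aestronglyMeasurable

/-- **Trace estimate for `C¹` functions.** Since the weight `|x| log (M / |x|)` is bounded, Hardy's
inequality controls `v - v ∘ f` in `L^n(Ω)`, and the norm of `v ∘ f` there controls the norm of
`v` on the boundary. -/
theorem exists_trace_estimate (hf : IsRadialBoundaryField Ω f) (hΩ : IsC1Domain Ω)
    (hb : Bornology.IsBounded Ω) (hs : StarConvex ℝ 0 Ω) :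
    ∃ C : ℝ≥0∞, C ≠ ⊤ ∧ ∀ (v : Euc (k + 2) → ℝ) (Dv : Euc (k + 2) → Euc (k + 2)),
      ContDiff ℝ 1 v → (∀ x ∈ Ω, ∀ e, fderiv ℝ v x e = inner ℝ (Dv x) e) →
      eLpNorm v ((k + 2 : ℕ) : ℝ≥0∞) (surfaceMeasure Ω) ≤
        C * (eLpNorm v ((k + 2 : ℕ) : ℝ≥0∞) (volume.restrict Ω) +
          eLpNorm Dv ((k + 2 : ℕ) : ℝ≥0∞) (volume.restrict Ω)) := by
  obtain ⟨C0, hC0, hle⟩ := exists_surfaceMeasure_le (m := k + 1) hf hΩ hb hs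
  obtain ⟨B, hB⟩ := hb.isCompact_closure.isBounded.exists_norm_le
  set M : ℝ := |B| + 1 with hM
  have hM0 : 0 < M := by positivity
  have hMcl : ∀ x ∈ closure Ω, ‖x‖ < M := fun x hx => by
    have := hB x hx; linarith [le_abs_self B]
  set p : ℝ≥0∞ := ((k + 2 : ℕ) : ℝ≥0∞) with hp
  have hptop : p ≠ ⊤ := ENNReal.natCast_ne_top _
  have hp1 : 1 ≤ p := by rw [hp]; exact_mod_cast (by omega : 1 ≤ k + 2)
  set c := ENNReal.ofReal ((k + 2) / (k + 1)) with hc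
  set K : ℝ≥0∞ := C0 ^ (1 / p).toReal with hK
  have hKtop : K ≠ ⊤ := ENNReal.rpow_ne_top_of_nonneg ENNReal.toReal_nonneg hC0
  refine ⟨K * (1 + ENNReal.ofReal M * c), ENNReal.mul_ne_top hKtop
    (ENNReal.add_ne_top.2 ⟨ENNReal.one_ne_top, ENNReal.mul_ne_top ENNReal.ofReal_ne_top
      ENNReal.ofReal_ne_top⟩), fun v Dv hv hgrad => ?_⟩
  have hvf := aestronglyMeasurable_comp_field hf hΩ hv.continuous
  have hvm : AEStronglyMeasurable v (volume.restrict Ω) := hv.continuous.aestronglyMeasurable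
  have h0 : ∀ᵐ x ∂(volume.restrict Ω), x ≠ 0 :=
    ae_restrict_of_ae (by simp [ae_iff])
  have e1 : eLpNorm v p (surfaceMeasure Ω) ≤
      K * eLpNorm (fun x => v (f x)) p (volume.restrict Ω) := by
    refine (eLpNorm_mono_measure v hle).trans (le_of_eq ?_)
    rw [eLpNorm_smul_measure_of_ne_top hptop, smul_eq_mul,
      eLpNorm_map_measure hv.continuous.aestronglyMeasurable (hf.aemeasurable hΩ)]
    rfl
  have e2 : eLpNorm (fun x => v x - v (f x)) p (volume.restrict Ω) ≤
      ENNReal.ofReal M * eLpNorm (hardyQuotient f M v v) p (volume.restrict Ω) := by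
    refine eLpNorm_le_mul_eLpNorm_of_ae_le_mul ?_ p
    filter_upwards [h0, ae_restrict_mem hΩ.isOpen.measurableSet] with x hx0 hx
    have hxn : 0 < ‖x‖ := norm_pos_iff.2 hx0
    have hlog : 0 < Real.log (M / ‖x‖) :=
      Real.log_pos ((one_lt_div hxn).2 (hMcl x (subset_closure hx)))
    have hw : ‖x‖ * Real.log (M / ‖x‖) ≤ M := by
      have h1 := Real.log_le_self (div_pos hM0 hxn).le
      calc _ ≤ ‖x‖ * (M / ‖x‖) := by gcongr
        _ = M := by field_simp
    have hw0 : 0 < ‖x‖ * Real.log (M / ‖x‖) := by positivity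
    rw [hardyQuotient, norm_div, Real.norm_of_nonneg hw0.le, mul_div_assoc', le_div_iff₀ hw0,
      mul_comm M]
    exact mul_le_mul_of_nonneg_left hw (norm_nonneg _)
  have e3 := hardy_eLpNorm hf hΩ hb hs hMcl hv hgrad
  have e4 : eLpNorm (radialPart Dv) p (volume.restrict Ω) ≤ eLpNorm Dv p (volume.restrict Ω) :=
    eLpNorm_mono_ae (Eventually.of_forall fun x => abs_radialPart_le Dv x)
  set a := eLpNorm v p (volume.restrict Ω) with ha
  set b := eLpNorm Dv p (volume.restrict Ω) with hb'
  have e5 : eLpNorm (fun x => v (f x)) p (volume.restrict Ω) ≤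
      a + ENNReal.ofReal M * (c * b) := by
    have : (fun x => v (f x)) = v - (fun x => v x - v (f x)) := by ext x; simp
    rw [this]
    refine (eLpNorm_sub_le hvm (hvm.sub hvf) hp1).trans (add_le_add le_rfl (e2.trans ?_))
    gcongr
    exact e3.trans (by gcongr)
  calc _ ≤ K * (a + ENNReal.ofReal M * (c * b)) := e1.trans (by gcongr)
    _ ≤ K * ((a + b) + ENNReal.ofReal M * (c * (a + b))) := by
        gcongr
        · exact le_self_add
        · exact le_add_self
    _ = _ := by ring

theorem isFiniteMeasure_surfaceMeasure (hf : IsRadialBoundaryField Ω f) (hΩ : IsC1Domain Ω)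
    (hb : Bornology.IsBounded Ω) (hs : StarConvex ℝ 0 Ω) : IsFiniteMeasure (surfaceMeasure Ω) := by
  obtain ⟨C0, hC0, hle⟩ := exists_surfaceMeasure_le (m := k + 1) hf hΩ hb hs
  refine ⟨lt_of_le_of_lt (hle Set.univ) ?_⟩
  rw [Measure.smul_apply, smul_eq_mul, Measure.map_apply_of_aemeasurable (hf.aemeasurable hΩ)
    MeasurableSet.univ, Set.preimage_univ, Measure.restrict_apply_univ]
  exact ENNReal.mul_lt_top hC0.lt_top hb.measure_lt_top

/-- Existence of the trace: the restrictions to `∂Ω` of smooth approximations are Cauchy. -/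
theorem exists_isTrace (hf : IsRadialBoundaryField Ω f) (hΩ : IsC1Domain Ω)
    (hb : Bornology.IsBounded Ω) (hs : StarConvex ℝ 0 Ω) {u : Euc (k + 2) → ℝ}
    {Du : Euc (k + 2) → Euc (k + 2)} (hu : MemW1 Ω ((k + 2 : ℕ) : ℝ≥0∞) u Du) :
    ∃ g, IsTrace Ω ((k + 2 : ℕ) : ℝ≥0∞) u Du g := by
  obtain ⟨C, hC, hest⟩ := exists_trace_estimate hf hΩ hb hs
  choose v Dv hv hDv hgrad hvu hDvu _ using fun j : ℕ => exists_contDiff_approx hΩ.isOpen hb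
    (fun x hx s h0 h1 => hf.smul_mem_of_mem_closure hΩ hb hs hx h0 h1)
    (p := k + 2) (by omega) hu (ε := (2⁻¹ : ℝ) ^ j) (by positivity)
  set p : ℝ≥0∞ := ((k + 2 : ℕ) : ℝ≥0∞) with hp
  have hp1 : 1 ≤ p := by rw [hp]; exact_mod_cast (by omega : 1 ≤ k + 2)
  have hε : ∀ j : ℕ, ENNReal.ofReal ((2⁻¹ : ℝ) ^ j) = (2⁻¹ : ℝ≥0∞) ^ j := fun j => by
    rw [ENNReal.ofReal_pow (by positivity), ENNReal.ofReal_inv_of_pos two_pos,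
      ENNReal.ofReal_ofNat]
  simp only [hε] at hvu hDvu
  have hW : ∀ j, MemW1 Ω p (v j) (Dv j) := fun j =>
    memW1_of_contDiff hΩ.isOpen hb p (hv j) (hDv j) (hgrad j)
  have htend : Tendsto (fun j : ℕ => (2⁻¹ : ℝ≥0∞) ^ j) atTop (𝓝 0) :=
    ENNReal.tendsto_pow_atTop_nhds_zero_of_lt_one (by simp)
  have hmem : ∀ j, MemLp (v j) p (surfaceMeasure Ω) := fun j =>
    ⟨(hv j).continuous.aestronglyMeasurable, (hest _ _ (hv j) (hgrad j)).trans_lt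
      (ENNReal.mul_lt_top hC.lt_top (ENNReal.add_lt_top.2
        ⟨(hW j).memLp.eLpNorm_lt_top, (hW j).memLp_grad.eLpNorm_lt_top⟩))⟩
  have hpow : ∀ N i : ℕ, N ≤ i → (2⁻¹ : ℝ≥0∞) ^ i ≤ 2⁻¹ ^ N := fun N i h =>
    pow_le_pow_right_of_le_one' (by simp) h
  have hdiff : ∀ {F : Type} [NormedAddCommGroup F] {w : ℕ → Euc (k + 2) → F}
      {z : Euc (k + 2) → F}, (∀ j, AEStronglyMeasurable (w j) (volume.restrict Ω)) →
      AEStronglyMeasurable z (volume.restrict Ω) →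
      (∀ j, eLpNorm (fun x => w j x - z x) p (volume.restrict Ω) ≤ 2⁻¹ ^ j) →
      ∀ N i j : ℕ, N ≤ i → N ≤ j →
        eLpNorm (w i - w j) p (volume.restrict Ω) ≤ 2 * 2⁻¹ ^ N := by
    intro F _ w z hwm hzm hwz N i j hi hj
    have : w i - w j = (fun x => w i x - z x) - (fun x => w j x - z x) := by ext x; simp
    rw [this, two_mul]
    exact (eLpNorm_sub_le ((hwm i).sub hzm) ((hwm j).sub hzm) hp1).trans
      (add_le_add ((hwz i).trans (hpow N i hi)) ((hwz j).trans (hpow N j hj)))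
  have hcauchy : ∀ N i j : ℕ, N ≤ i → N ≤ j →
      eLpNorm (v i - v j) p (surfaceMeasure Ω) < (C * 4 + 1) * 2⁻¹ ^ N := by
    intro N i j hi hj
    have h1 := hest (v i - v j) (fun x => Dv i x - Dv j x) ((hv i).sub (hv j)) (fun x hx e => by
      rw [fderiv_sub ((hv i).differentiable one_ne_zero x) ((hv j).differentiable one_ne_zero x),
        sub_apply, hgrad i x hx, hgrad j x hx, inner_sub_left])
    have h2 := hdiff (fun j => (hv j).continuous.aestronglyMeasurable) hu.memLp.1 hvu N i j hi hj
    have h3 := hdiff (fun j => (hDv j).aestronglyMeasurable) hu.memLp_grad.1 hDvu N i j hi hj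
    have hfin : C * 4 * (2⁻¹ : ℝ≥0∞) ^ N ≠ ⊤ := ENNReal.mul_ne_top
      (ENNReal.mul_ne_top hC (by simp)) (ENNReal.pow_ne_top (by simp))
    calc _ ≤ C * (2 * 2⁻¹ ^ N + 2 * 2⁻¹ ^ N) := h1.trans (by gcongr; exact h3)
      _ = C * 4 * 2⁻¹ ^ N := by ring
      _ < C * 4 * 2⁻¹ ^ N + 2⁻¹ ^ N := ENNReal.lt_add_right hfin (by simp)
      _ = _ := by ring
  obtain ⟨g, hg, hlim⟩ := Lp.cauchy_complete_eLpNorm hp1 hmem (B := fun N => (C * 4 + 1) * 2⁻¹ ^ N)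
    (by
      rw [ENNReal.tsum_mul_left, ENNReal.tsum_geometric, ENNReal.one_sub_inv_two, inv_inv]
      exact ENNReal.mul_ne_top (ENNReal.add_ne_top.2 ⟨ENNReal.mul_ne_top hC (by simp), by simp⟩)
        (by simp)) hcauchy
  exact ⟨g, hg, v, Dv, fun j => ⟨hW j, (hv j).continuous.continuousOn⟩,
    tendsto_of_tendsto_of_tendsto_of_le_of_le tendsto_const_nhds htend (fun _ => zero_le) hvu,
    tendsto_of_tendsto_of_tendsto_of_le_of_le tendsto_const_nhds htend (fun _ => zero_le) hDvu,
    hlim⟩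

/-- The sequence defining a trace may be taken to consist of `C¹` functions. -/
theorem IsTrace.exists_contDiff (hf : IsRadialBoundaryField Ω f) (hΩ : IsC1Domain Ω)
    (hb : Bornology.IsBounded Ω) (hs : StarConvex ℝ 0 Ω) {u g : Euc (k + 2) → ℝ}
    {Du : Euc (k + 2) → Euc (k + 2)} (hu : MemW1 Ω ((k + 2 : ℕ) : ℝ≥0∞) u Du)
    (hg : IsTrace Ω ((k + 2 : ℕ) : ℝ≥0∞) u Du g) :
    ∃ (w : ℕ → Euc (k + 2) → ℝ) (Dw : ℕ → Euc (k + 2) → Euc (k + 2)),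
      (∀ j, ContDiff ℝ 1 (w j) ∧ Continuous (Dw j) ∧
        ∀ x ∈ Ω, ∀ e, fderiv ℝ (w j) x e = inner ℝ (Dw j x) e) ∧
      Tendsto (fun j => eLpNorm (w j - u) ((k + 2 : ℕ) : ℝ≥0∞) (volume.restrict Ω)) atTop (𝓝 0) ∧
      Tendsto (fun j => eLpNorm (Dw j - Du) ((k + 2 : ℕ) : ℝ≥0∞) (volume.restrict Ω)) atTop
        (𝓝 0) ∧
      Tendsto (fun j => eLpNorm (w j - g) ((k + 2 : ℕ) : ℝ≥0∞) (surfaceMeasure Ω)) atTop (𝓝 0) := by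
  obtain ⟨hgL, v, Dv, hv, hvu, hDvu, hvg⟩ := hg
  choose w Dw hw hDw hgrad hwv hDwv hwunif using fun j : ℕ => exists_contDiff_approx hΩ.isOpen hb
    (fun x hx s h0 h1 => hf.smul_mem_of_mem_closure hΩ hb hs hx h0 h1)
    (p := k + 2) (by omega) (hv j).1 (ε := 1 / ((j : ℝ) + 1)) (by positivity)
  have hfin := isFiniteMeasure_surfaceMeasure hf hΩ hb hs
  set p : ℝ≥0∞ := ((k + 2 : ℕ) : ℝ≥0∞) with hp
  have hp1 : 1 ≤ p := by rw [hp]; exact_mod_cast (by omega : 1 ≤ k + 2)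
  have hε : Tendsto (fun j : ℕ => ENNReal.ofReal (1 / ((j : ℝ) + 1))) atTop (𝓝 0) := by
    simpa using ENNReal.tendsto_ofReal (tendsto_one_div_add_atTop_nhds_zero_nat (𝕜 := ℝ))
  have hadd : ∀ {F : Type} [NormedAddCommGroup F] {μ : Measure (Euc (k + 2))}
      {a b : ℕ → Euc (k + 2) → F} {z : Euc (k + 2) → F} {K : ℝ≥0∞}, K ≠ ⊤ →
      (∀ j, AEStronglyMeasurable (a j) μ) → (∀ j, AEStronglyMeasurable (b j) μ) →
      AEStronglyMeasurable z μ →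
      (∀ j : ℕ, eLpNorm (fun x => a j x - b j x) p μ ≤ K * ENNReal.ofReal (1 / ((j : ℝ) + 1))) →
      Tendsto (fun j => eLpNorm (fun x => b j x - z x) p μ) atTop (𝓝 0) →
      Tendsto (fun j => eLpNorm (a j - z) p μ) atTop (𝓝 0) := by
    intro F _ μ a b z K hK ha hb hz hab hbz
    have h1 := (ENNReal.Tendsto.const_mul hε (Or.inr hK)).add hbz
    rw [mul_zero, add_zero] at h1
    refine tendsto_of_tendsto_of_tendsto_of_le_of_le tendsto_const_nhds h1 (fun _ => zero_le)
      fun j => ?_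
    have : a j - z = (fun x => a j x - b j x) + (fun x => b j x - z x) := by ext x; simp
    simp only [this]
    exact (eLpNorm_add_le ((ha j).sub (hb j)) ((hb j).sub hz) hp1).trans
      (add_le_add (hab j) le_rfl)
  refine ⟨w, Dw, fun j => ⟨hw j, hDw j, hgrad j⟩, ?_, ?_, ?_⟩
  · exact hadd ENNReal.one_ne_top (fun j => (hw j).continuous.aestronglyMeasurable)
      (fun j => (hv j).1.memLp.1) hu.memLp.1 (fun j => by rw [one_mul]; exact hwv j) hvu
  · exact hadd ENNReal.one_ne_top (fun j => (hDw j).aestronglyMeasurable)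
      (fun j => (hv j).1.memLp_grad.1) hu.memLp_grad.1 (fun j => by rw [one_mul]; exact hDwv j) hDvu
  · refine hadd (K := surfaceMeasure Ω Set.univ ^ p.toReal⁻¹)
      (ENNReal.rpow_ne_top_of_nonneg (by positivity) (measure_ne_top _ _))
      (fun j => (hw j).continuous.aestronglyMeasurable)
      (fun j => ((hv j).2.mono frontier_subset_closure).aestronglyMeasurable
        isClosed_frontier.measurableSet) hgL.1 (fun j => ?_) hvg
    refine eLpNorm_le_of_ae_bound ?_
    filter_upwards [ae_restrict_mem isClosed_frontier.measurableSet] with x hx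
    exact hwunif j (hv j).2 x (frontier_subset_closure hx)

theorem ae_comp_field_of_ae_surfaceMeasure (hf : IsRadialBoundaryField Ω f) (hΩ : IsC1Domain Ω)
    (hb : Bornology.IsBounded Ω) (hs : StarConvex ℝ 0 Ω) {P : Euc (k + 2) → Prop}
    (hP : ∀ᵐ y ∂(surfaceMeasure Ω), P y) : ∀ᵐ x ∂(volume.restrict Ω), P (f x) := by
  rw [ae_iff, surfaceMeasure, Measure.restrict_apply' isClosed_frontier.measurableSet] at hP
  have hd : ((k + 2 : ℕ) : ℝ) - 1 = ((k + 1 : ℕ) : ℝ) := by push_cast; ring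
  rw [hd] at hP
  have h := volume_preimage_eq_zero_of_surface_null (m := k + 1) hf hΩ hb hs hP
  rw [ae_iff, Measure.restrict_apply' hΩ.isOpen.measurableSet, Set.inter_comm]
  exact h

/-- **Hardy's inequality with boundary trace**, in terms of `L^n` norms. The constant `M` in the
weight is the limit of larger constants, for which the inequality holds for `C¹` functions. -/
theorem hardyQuotient_trace (hf : IsRadialBoundaryField Ω f) (hΩ : IsC1Domain Ω)
    (hb : Bornology.IsBounded Ω) (hs : StarConvex ℝ 0 Ω) {M : ℝ}
    (hM : ∀ x ∈ closure Ω, ‖x‖ ≤ M) (hM' : ∀ x ∈ Ω, x ≠ 0 → ‖x‖ < M) {u g : Euc (k + 2) → ℝ}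
    {Du : Euc (k + 2) → Euc (k + 2)} (hu : MemW1 Ω ((k + 2 : ℕ) : ℝ≥0∞) u Du)
    (hg : IsTrace Ω ((k + 2 : ℕ) : ℝ≥0∞) u Du g) :
    AEStronglyMeasurable (hardyQuotient f M u g) (volume.restrict Ω) ∧
    eLpNorm (hardyQuotient f M u g) ((k + 2 : ℕ) : ℝ≥0∞) (volume.restrict Ω) ≤
      ENNReal.ofReal ((k + 2) / (k + 1)) *
        eLpNorm (radialPart Du) ((k + 2 : ℕ) : ℝ≥0∞) (volume.restrict Ω) := by
  obtain ⟨w0, Dw0, hw0, hwu0, hDwu0, hwg0⟩ := hg.exists_contDiff hf hΩ hb hs hu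
  set p : ℝ≥0∞ := ((k + 2 : ℕ) : ℝ≥0∞) with hp
  have hp0 : p ≠ 0 := by simp [hp]
  have hp1 : 1 ≤ p := by rw [hp]; exact_mod_cast (by omega : 1 ≤ k + 2)
  -- pass to a subsequence that converges almost everywhere, in `Ω` and on `∂Ω`
  obtain ⟨ns, hns, hae1⟩ := (tendstoInMeasure_of_tendsto_eLpNorm hp0
    (fun j => (hw0 j).1.continuous.aestronglyMeasurable) hu.memLp.1 hwu0).exists_seq_tendsto_ae
  obtain ⟨ms, hms, hae2⟩ := (tendstoInMeasure_of_tendsto_eLpNorm hp0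
    (fun j => (hw0 (ns j)).1.continuous.aestronglyMeasurable) hg.1.1
    (hwg0.comp hns.tendsto_atTop)).exists_seq_tendsto_ae
  set w := fun j => w0 (ns (ms j)) with hwdef
  set Dw := fun j => Dw0 (ns (ms j)) with hDwdef
  have hw : ∀ j, ContDiff ℝ 1 (w j) ∧ Continuous (Dw j) ∧
        ∀ x ∈ Ω, ∀ e, fderiv ℝ (w j) x e = inner ℝ (Dw j x) e := fun j => hw0 _
  have hDwu : Tendsto (fun j => eLpNorm (Dw j - Du) p (volume.restrict Ω)) atTop (𝓝 0) :=
    hDwu0.comp (hns.tendsto_atTop.comp hms.tendsto_atTop)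
  have hae3 := ae_comp_field_of_ae_surfaceMeasure hf hΩ hb hs hae2
  set Mk : ℕ → ℝ := fun j => M + 1 / ((j : ℝ) + 1) with hMk
  have hMk' : ∀ j, ∀ x ∈ closure Ω, ‖x‖ < Mk j := fun j x hx => by
    have h1 := hM x hx
    have h2 : 0 < 1 / ((j : ℝ) + 1) := by positivity
    simp only [hMk]; linarith
  have hMlim : Tendsto Mk atTop (𝓝 M) := by
    simpa [hMk] using (tendsto_one_div_add_atTop_nhds_zero_nat (𝕜 := ℝ)).const_add M
  have h0 : ∀ᵐ x ∂(volume.restrict Ω), x ≠ 0 := ae_restrict_of_ae (by simp [ae_iff])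
  have hlim : ∀ᵐ x ∂(volume.restrict Ω), Tendsto (fun j => hardyQuotient f (Mk j) (w j) (w j) x)
      atTop (𝓝 (hardyQuotient f M u g x)) := by
    filter_upwards [h0, ae_restrict_mem hΩ.isOpen.measurableSet, hae1, hae3] with x hx0 hx h1 h3
    have hxn : 0 < ‖x‖ := norm_pos_iff.2 hx0
    have hlt := hM' x hx hx0
    have hlog : 0 < Real.log (M / ‖x‖) := Real.log_pos ((one_lt_div hxn).2 hlt)
    have h4 : Tendsto (fun j => Real.log (Mk j / ‖x‖)) atTop (𝓝 (Real.log (M / ‖x‖))) :=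
      (hMlim.div_const _).log (div_pos (hxn.trans hlt) hxn).ne'
    exact ((h1.comp hms.tendsto_atTop).sub h3).div (h4.const_mul _) (by positivity)
  have hmeas : ∀ j, AEStronglyMeasurable (hardyQuotient f (Mk j) (w j) (w j))
      (volume.restrict Ω) := by
    intro j
    have h1 : AEStronglyMeasurable (fun x => w j x - w j (f x)) (volume.restrict Ω) :=
      (hw j).1.continuous.aestronglyMeasurable.sub
        (aestronglyMeasurable_comp_field hf hΩ (hw j).1.continuous)
    have h2 : Measurable (fun x : Euc (k + 2) => ‖x‖ * Real.log (Mk j / ‖x‖)) := by fun_prop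
    exact (h1.aemeasurable.div h2.aemeasurable).aestronglyMeasurable
  refine ⟨aestronglyMeasurable_of_tendsto_ae atTop hmeas hlim, ?_⟩
  set c := ENNReal.ofReal ((k + 2) / (k + 1)) with hc
  set b := eLpNorm (radialPart Du) p (volume.restrict Ω) with hbdef
  have hle : ∀ j, eLpNorm (hardyQuotient f (Mk j) (w j) (w j)) p (volume.restrict Ω) ≤
      c * (eLpNorm (Dw j - Du) p (volume.restrict Ω) + b) := by
    intro j
    refine (hardy_eLpNorm hf hΩ hb hs (hMk' j) (hw j).1 (hw j).2.2).trans ?_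
    gcongr
    have hsplit : radialPart (Dw j) = radialPart (Dw j - Du) + radialPart Du := by
      ext x; simp [radialPart, inner_sub_right]
    have hDm := (hw j).2.1.aestronglyMeasurable.sub hu.memLp_grad.1
    rw [hsplit]
    refine (eLpNorm_add_le (aestronglyMeasurable_radialPart hDm)
      (aestronglyMeasurable_radialPart hu.memLp_grad.1) hp1).trans (add_le_add ?_ le_rfl)
    exact eLpNorm_mono_ae (Eventually.of_forall fun x => abs_radialPart_le _ x)
  have hR : Tendsto (fun j => c * (eLpNorm (Dw j - Du) p (volume.restrict Ω) + b)) atTop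
      (𝓝 (c * b)) := by
    have := ENNReal.Tendsto.const_mul (hDwu.add_const b)
      (Or.inr (ENNReal.ofReal_ne_top (r := ((k : ℝ) + 2) / (k + 1))))
    rwa [zero_add] at this
  calc _ ≤ liminf (fun j => eLpNorm (hardyQuotient f (Mk j) (w j) (w j)) p (volume.restrict Ω))
        atTop := Lp.eLpNorm_lim_le_liminf_eLpNorm hmeas _ hlim
    _ ≤ liminf (fun j => c * (eLpNorm (Dw j - Du) p (volume.restrict Ω) + b)) atTop :=
        liminf_le_liminf (Eventually.of_forall hle)
    _ = c * b := hR.liminf_eq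

end Trace

/-! ### The inequality between integrals -/

theorem theorem2 (n : ℕ) (hn : 2 ≤ n)
    (Ω : Set (Euc n)) (hΩ : IsC1Domain Ω) (hΩ_bdd : Bornology.IsBounded Ω)
    (hΩ_star : StarConvex ℝ 0 Ω)
    (f : Euc n → Euc n) (hf : IsRadialBoundaryField Ω f)
    (M : ℝ) (hM : IsLUB ((fun x : Euc n => ‖x‖) '' Ω) M)
    (u : Euc n → ℝ) (Du : Euc n → Euc n) (hu : MemW1 Ω (n : ℝ≥0∞) u Du) :
    (∃ g : Euc n → ℝ, IsTrace Ω (n : ℝ≥0∞) u Du g) ∧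
    ∀ g : Euc n → ℝ, IsTrace Ω (n : ℝ≥0∞) u Du g →
      IntegrableOn
        (fun x => |u x - g (f x)| ^ n / (‖x‖ ^ n * Real.log (M / ‖x‖) ^ n)) Ω ∧
      ∫ x in Ω, |u x - g (f x)| ^ n / (‖x‖ ^ n * Real.log (M / ‖x‖) ^ n) ≤
        ((n : ℝ) / ((n : ℝ) - 1)) ^ n *
          ∫ x in Ω, |inner ℝ (‖x‖⁻¹ • x) (Du x)| ^ n := by
  obtain ⟨k, rfl⟩ : ∃ k, n = k + 2 := ⟨n - 2, by omega⟩
  refine ⟨exists_isTrace hf hΩ hΩ_bdd hΩ_star hu, fun g hg => ?_⟩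
  have hMΩ : ∀ x ∈ Ω, ‖x‖ ≤ M := fun x hx => hM.1 ⟨x, hx, rfl⟩
  have hMcl : ∀ x ∈ closure Ω, ‖x‖ ≤ M := fun x hx =>
    closure_minimal (t := {x | ‖x‖ ≤ M}) hMΩ (isClosed_le continuous_norm continuous_const) hx
  have hMlt : ∀ x ∈ Ω, x ≠ 0 → ‖x‖ < M := by
    intro x hx hx0
    obtain ⟨t, ht, -, -, hray⟩ := hf.exists_exit hΩ hΩ_bdd hΩ_star hx hx0
    have h1 := hMΩ _ ((hray ((1 + t) / 2) (by linarith)).1.2 (by linarith))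
    rw [norm_smul, Real.norm_of_nonneg (by linarith)] at h1
    have hxn := norm_pos_iff.2 hx0
    nlinarith
  obtain ⟨hmeas, hle⟩ := hardyQuotient_trace hf hΩ hΩ_bdd hΩ_star hMcl hMlt hu hg
  set p : ℝ≥0∞ := ((k + 2 : ℕ) : ℝ≥0∞) with hp
  have hp0 : p ≠ 0 := by simp [hp]
  have hptop : p ≠ ⊤ := ENNReal.natCast_ne_top _
  have hDu : MemLp (radialPart Du) p (volume.restrict Ω) :=
    hu.memLp_grad.mono (aestronglyMeasurable_radialPart hu.memLp_grad.1)
      (Eventually.of_forall fun x => abs_radialPart_le Du x)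
  have hQ : MemLp (hardyQuotient f M u g) p (volume.restrict Ω) :=
    ⟨hmeas, hle.trans_lt (ENNReal.mul_lt_top ENNReal.ofReal_lt_top hDu.eLpNorm_lt_top)⟩
  -- at `x = 0` both sides vanish, by the convention for division by zero
  have hpt : ∀ x ∈ Ω, ‖hardyQuotient f M u g x‖ ^ (k + 2) =
      |u x - g (f x)| ^ (k + 2) / (‖x‖ ^ (k + 2) * Real.log (M / ‖x‖) ^ (k + 2)) := by
    intro x hx
    have hw : 0 ≤ ‖x‖ * Real.log (M / ‖x‖) := by
      by_cases hx0 : x = 0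
      · simp [hx0]
      · have hxn := norm_pos_iff.2 hx0
        have := Real.log_pos ((one_lt_div hxn).2 (hMlt x hx hx0))
        positivity
    rw [hardyQuotient, norm_div, Real.norm_of_nonneg hw, Real.norm_eq_abs, div_pow, mul_pow]
  have hint := hQ.integrable_norm_pow (by omega)
  have hΩm := hΩ.isOpen.measurableSet
  refine ⟨(integrableOn_congr_fun hpt hΩm).1 hint, ?_⟩
  rw [← setIntegral_congr_fun hΩm hpt]
  rw [hQ.eLpNorm_eq_integral_rpow_norm hp0 hptop, hDu.eLpNorm_eq_integral_rpow_norm hp0 hptop,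
    ← ENNReal.ofReal_mul (by positivity), ENNReal.ofReal_le_ofReal_iff (by positivity)] at hle
  simp only [hp, ENNReal.toReal_natCast, Real.rpow_natCast] at hle
  set a := ∫ x in Ω, ‖hardyQuotient f M u g x‖ ^ (k + 2) with ha
  set b := ∫ x in Ω, ‖radialPart Du x‖ ^ (k + 2) with hb
  have ha0 : 0 ≤ a := integral_nonneg fun x => by positivity
  have hb0 : 0 ≤ b := integral_nonneg fun x => by positivity
  have h := pow_le_pow_left₀ (by positivity) hle (k + 2)
  rw [mul_pow, Real.rpow_inv_natCast_pow ha0 (by omega),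
    Real.rpow_inv_natCast_pow hb0 (by omega)] at h
  have hc : (((k + 2 : ℕ) : ℝ) / (((k + 2 : ℕ) : ℝ) - 1)) = (k + 2) / (k + 1) := by
    push_cast; congr 1; ring
  rw [hc]
  exact h
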